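/- Let $n\ge 1$ and let $\Omega\subset\mathbb{R}^n$ be a bounded, uniformly convex domain, that is, a nonempty bounded open convex set for which there is $\kappa>0$ such that every $x_0\in\partial\Omega$ admits a unit vector $\nu$ with $\frac{\kappa}{2}|x-x_0|^2\le\langle x-x_0,\nu\rangle$ for all $x\in\Omega$ close to $x_0$ (if $\partial\Omega$ is of class $C^2$, this means that the principal curvatures of $\partial\Omega$ are bounded below by a positive constant). Let $\phi\in C^0(\partial\Omega)$ and let $\psi\in\left(-\frac{n\pi}{2},\frac{n\pi}{2}\right)$ be a constant. For a symmetric matrix $A$ with eigenvalues $\lambda_1,\dots,\lambda_n$ (counted with multiplicity) put $F(A)=\sum_{i=1}^n\arctan\lambda_i$. Then there is exactly one function $u\in C^0(\overline\Omega)$ that is a viscosity solution of the Dirichlet problem \[ F(D^2u)=\psi \ \text{ in } \Omega,\qquad u=\phi \ \text{ on } \partial\Omega . \] Here $u$ is a viscosity solution if $u=\phi$ on $\partial\Omega$ and, for every $f\in C^2(\Omega)$ and $x_0\in\Omega$: if $u-f$ has a local maximum at $x_0$, then $F(D^2f(x_0))\ge\psi$; and if $u-f$ has a local minimum at $x_0$,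 then $F(D^2f(x_0))\le\psi$. -/

import Mathlib

open Set Topology

noncomputable section

/-- The operator `F(A) = ∑ arctan λᵢ`, the `λᵢ` being the eigenvalues of `A` counted with
multiplicity (for a symmetric `A` all the roots of the characteristic polynomial are real). -/
def lagrangianPhase {n : ℕ} (A : Matrix (Fin n) (Fin n) ℝ) : ℝ :=
  (A.charpoly.roots.map Real.arctan).sum

/-- On symmetric matrices, `lagrangianPhase` is the sum over Mathlib's list of eigenvalues. -/
theorem lagrangianPhase_eq {n : ℕ} {A : Matrix (Fin n) (Fin n) ℝ} (hA : A.IsHermitian) :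
    lagrangianPhase A = ∑ i, Real.arctan (hA.eigenvalues i) := by
  simp [lagrangianPhase, hA.roots_charpoly_eq_eigenvalues, List.sum_ofFn]

/-- The Hessian matrix `D²f(x)`. -/
def hessianMatrix {n : ℕ} (f : EuclideanSpace ℝ (Fin n) → ℝ) (x : EuclideanSpace ℝ (Fin n)) :
    Matrix (Fin n) (Fin n) ℝ :=
  Matrix.of fun i j =>
    fderiv ℝ (fderiv ℝ f) x (EuclideanSpace.single i 1) (EuclideanSpace.single j 1)

/-- `u` is a viscosity subsolution of `F(D²u) = ψ` in the open set `Ω`, i.e. `F(D²u) ≥ ψ`: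
whenever a `C²` function touches `u` from above (up to a constant) at `x₀`, it satisfies
`F(D²f(x₀)) ≥ ψ`. -/
structure IsViscositySubsolution {n : ℕ} (Ω : Set (EuclideanSpace ℝ (Fin n))) (ψ : ℝ)
    (u : EuclideanSpace ℝ (Fin n) → ℝ) : Prop where
  usc : UpperSemicontinuousOn u Ω
  test : ∀ f : EuclideanSpace ℝ (Fin n) → ℝ, ContDiffOn ℝ 2 f Ω → ∀ x₀ ∈ Ω,
    IsLocalMaxOn (fun x => u x - f x) Ω x₀ → ψ ≤ lagrangianPhase (hessianMatrix f x₀)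

/-- `u` is a viscosity supersolution of `F(D²u) = ψ` in the open set `Ω`, i.e. `F(D²u) ≤ ψ`. -/
structure IsViscositySupersolution {n : ℕ} (Ω : Set (EuclideanSpace ℝ (Fin n))) (ψ : ℝ)
    (u : EuclideanSpace ℝ (Fin n) → ℝ) : Prop where
  lsc : LowerSemicontinuousOn u Ω
  test : ∀ f : EuclideanSpace ℝ (Fin n) → ℝ, ContDiffOn ℝ 2 f Ω → ∀ x₀ ∈ Ω,
    IsLocalMinOn (fun x => u x - f x) Ω x₀ → lagrangianPhase (hessianMatrix f x₀) ≤ ψ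

/-- `u` is continuous on the closure of `Ω`, solves `F(D²u) = ψ` in `Ω` in the viscosity sense
and equals `φ` on the boundary. Only the values of `u` on the closure of `Ω` and those of `φ` on
the boundary of `Ω` matter. -/
structure IsDirichletSolution {n : ℕ} (Ω : Set (EuclideanSpace ℝ (Fin n))) (ψ : ℝ)
    (φ u : EuclideanSpace ℝ (Fin n) → ℝ) : Prop where
  continuousOn : ContinuousOn u (closure Ω)
  subsolution : IsViscositySubsolution Ω ψ u
  supersolution : IsViscositySupersolution Ω ψ u
  boundary : ∀ x ∈ frontier Ω, u x = φ x

/-- Uniformly convex domains: nonempty open convex sets whose boundary has curvature bounded below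
by a positive constant `κ`. The bound says that, with inner unit normal `ν` at `x₀ ∈ ∂Ω`, near
`x₀` the set `Ω` lies in the region `κ/2 |x - x₀|² ≤ ⟨x - x₀, ν⟩`, that is, in the
ball of radius `1/κ` through `x₀` centred at `x₀ + ν/κ`. If `∂Ω` is `C²`, then locally
`Ω = {xₙ > (k₁ x₁² + ⋯ + kₙ₋₁ xₙ₋₁²)/2 + o(|x'|²)}` and the existence of such a `κ > 0` says
exactly that the principal curvatures `kᵢ` of `∂Ω` are bounded below by a positive constant. No
regularity of `∂Ω` is required. -/
structure IsUniformlyConvexDomain {n : ℕ} (Ω : Set (EuclideanSpace ℝ (Fin n))) : Prop where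
  isOpen : IsOpen Ω
  nonempty : Ω.Nonempty
  convex : Convex ℝ Ω
  curvature : ∃ κ : ℝ, 0 < κ ∧ ∀ x₀ ∈ frontier Ω, ∃ ν : EuclideanSpace ℝ (Fin n), ‖ν‖ = 1 ∧
    ∀ᶠ x in 𝓝[Ω] x₀, κ / 2 * ‖x - x₀‖ ^ 2 ≤ inner ℝ (x - x₀) ν

end

/-
The equation `F(D²u) = ψ` is elliptic and does not depend on `x`, and only the following is needed
of it: `A ↦ F(A) - ψ` is monotone, strictly increasing and continuous along the lines `A + c • 1`,
and vanishes at `tan(ψ/n) • 1`, which makes sense because `|ψ| < nπ/2`.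

Uniqueness is the comparison principle. If a subsolution `u` and a supersolution `-v` violate it,
then so do `u + δ|x|²/2` and `-v` for small `δ > 0`. Sup-convolution makes both `u` and `v`
semiconvex; by Jensen's lemma, the slopes of the affine functions touching their sum from above fill
a ball while being almost everywhere differentiable on the contact set, so that there is a contact
point at which both have second order expansions, with Hessians `A ≤ -B`. This contradicts
ellipticity, because `δ` makes one of the two inequalities strict.

Existence is Perron's method. At `x₀ ∈ ∂Ω` strict convexity provides a linear function vanishing at
`x₀` and positive on the rest of the closure of `Ω`; a large multiple of it, subtracted from a
quadratic solution of Hessian `tan(ψ/n) • 1`, is a barrier from below. Barriers from above are the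
same thing for the dual operator `A ↦ -F(-A)`, which is satisfied by `-u`.
-/

open Filter
open scoped RealInnerProductSpace

section Eigenvalues

variable {𝕜 E : Type*} [RCLike 𝕜] [NormedAddCommGroup E] [InnerProductSpace 𝕜 E]
  [FiniteDimensional 𝕜 E] {n : ℕ} {S T : E →ₗ[𝕜] E}

theorem re_inner_apply_self_eq_sum_eigenvalues (hS : S.IsSymmetric)
    (hn : Module.finrank 𝕜 E = n) (x : E) :
    RCLike.re (inner 𝕜 (S x) x) =
      ∑ j, hS.eigenvalues hn j * ‖inner 𝕜 (hS.eigenvectorBasis hn j) x‖ ^ 2 := by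
  rw [← (hS.eigenvectorBasis hn).sum_inner_mul_inner (S x) x, map_sum]
  refine Finset.sum_congr rfl fun j _ => ?_
  rw [hS, hS.apply_eigenvectorBasis hn j, inner_smul_right, mul_assoc, RCLike.re_ofReal_mul,
    inner_mul_symm_re_eq_norm, norm_mul, norm_inner_symm x, sq]

/-- The proof is a dimension count: some nonzero vector is orthogonal both to the eigenvectors of
`S` with index `> i` and to those of `T` with index `< i`. -/
theorem eigenvalues_le_eigenvalues_of_le (hS : S.IsSymmetric) (hT : T.IsSymmetric)
    (hn : Module.finrank 𝕜 E = n) (h : S ≤ T) (i : Fin n) :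
    hS.eigenvalues hn i ≤ hT.eigenvalues hn i := by
  set e := hS.eigenvectorBasis hn with he
  set b := hT.eigenvectorBasis hn with hb
  obtain ⟨x, hx₀, hxe, hxb⟩ : ∃ x : E, x ≠ 0 ∧ (∀ j, i < j → inner 𝕜 (e j) x = 0) ∧
      ∀ j, j < i → inner 𝕜 (b j) x = 0 := by
    let L : E →ₗ[𝕜] ({j : Fin n // j ≠ i} → 𝕜) :=
      LinearMap.pi fun j => innerₛₗ 𝕜 (if i < j.1 then e j.1 else b j.1)
    have hker : LinearMap.ker L ≠ ⊥ := by
      apply LinearMap.ker_ne_bot_of_finrank_lt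
      have hi := i.2
      simp only [Module.finrank_fintype_fun_eq_card, Fintype.card_subtype_compl, Fintype.card_fin,
        Fintype.card_unique, hn]
      omega
    obtain ⟨x, hx, hx₀⟩ := (Submodule.ne_bot_iff _).1 hker
    have hL (j : Fin n) (hj : j ≠ i) : inner 𝕜 (if i < j then e j else b j) x = 0 :=
      congrFun (LinearMap.mem_ker.1 hx) ⟨j, hj⟩
    refine ⟨x, hx₀, fun j hj => ?_, fun j hj => ?_⟩
    · simpa only [if_pos hj] using hL j hj.ne'
    · simpa only [if_neg hj.not_gt] using hL j hj.ne
  have lower : hS.eigenvalues hn i * ‖x‖ ^ 2 ≤ RCLike.re (inner 𝕜 (S x) x) := by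
    rw [re_inner_apply_self_eq_sum_eigenvalues hS hn, ← e.sum_sq_norm_inner_right x,
      Finset.mul_sum]
    refine Finset.sum_le_sum fun j _ => ?_
    rcases lt_or_ge i j with hij | hij
    · simp [← he, hxe j hij]
    · exact mul_le_mul_of_nonneg_right (hS.eigenvalues_antitone hn hij) (sq_nonneg _)
  have upper : RCLike.re (inner 𝕜 (T x) x) ≤ hT.eigenvalues hn i * ‖x‖ ^ 2 := by
    rw [re_inner_apply_self_eq_sum_eigenvalues hT hn, ← b.sum_sq_norm_inner_right x,
      Finset.mul_sum]
    refine Finset.sum_le_sum fun j _ => ?_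
    rcases lt_or_ge j i with hij | hij
    · simp [← hb, hxb j hij]
    · exact mul_le_mul_of_nonneg_right (hT.eigenvalues_antitone hn hij) (sq_nonneg _)
  have hST : RCLike.re (inner 𝕜 (S x) x) ≤ RCLike.re (inner 𝕜 (T x) x) := by
    have := (LinearMap.le_def S T |>.1 h).re_inner_nonneg_left x
    rwa [LinearMap.sub_apply, inner_sub_left, map_sub, sub_nonneg] at this
  exact le_of_mul_le_mul_right (lower.trans (hST.trans upper)) (by positivity)

end Eigenvalues

section Elliptic

variable {E : Type*} [NormedAddCommGroup E] [InnerProductSpace ℝ E]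

theorem le_iff_forall_inner_le {S T : E →L[ℝ] E} (hS : S.IsSymmetric) (hT : T.IsSymmetric) :
    S ≤ T ↔ ∀ x, ⟪S x, x⟫ ≤ ⟪T x, x⟫ := by
  have hTS : (T - S).IsSymmetric := hT.sub hS
  simp only [ContinuousLinearMap.le_def, ContinuousLinearMap.isPositive_def, hTS, true_and,
    ContinuousLinearMap.reApplyInnerSelf_apply, sub_apply, inner_sub_left, map_sub,
    RCLike.re_to_real, sub_nonneg]

theorem isSymmetric_neg {T : E →L[ℝ] E} (hT : T.IsSymmetric) : (-T).IsSymmetric := fun x y => by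
  simpa using hT x y

theorem isSymmetric_add_smul_one {T : E →L[ℝ] E} (hT : T.IsSymmetric) (c : ℝ) :
    (T + c • 1).IsSymmetric := fun x y => by
  have := hT x y
  simp_all [inner_add_left, inner_add_right, inner_smul_left, inner_smul_right]

/-- Elliptic operators `F`, regarded as functions of the Hessian: `F` is monotone on the symmetric
operators, and strictly increasing and continuous along each line `T + c • 1`. -/
structure IsElliptic (F : (E →L[ℝ] E) → ℝ) : Prop where
  mono : ∀ {S T : E →L[ℝ] E}, S.IsSymmetric → T.IsSymmetric → S ≤ T → F S ≤ F T
  lt_add_smul_one : ∀ {T : E →L[ℝ] E} {c : ℝ}, T.IsSymmetric → 0 < c → F T < F (T + c • 1)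
  continuous_add_smul_one : ∀ T : E →L[ℝ] E, Continuous fun c : ℝ => F (T + c • 1)

/-- The operator of the equation satisfied by `-u` when `F (D²u) = 0`. -/
def dualOperator (F : (E →L[ℝ] E) → ℝ) (T : E →L[ℝ] E) : ℝ :=
  -F (-T)

variable {F : (E →L[ℝ] E) → ℝ}

@[simp]
theorem dualOperator_dualOperator (F : (E →L[ℝ] E) → ℝ) : dualOperator (dualOperator F) = F := by
  ext T
  simp [dualOperator]

namespace IsElliptic

theorem sub_const (hF : IsElliptic F) (c : ℝ) : IsElliptic fun T => F T - c where
  mono hS hT h := sub_le_sub_right (hF.mono hS hT h) c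
  lt_add_smul_one hT hc := sub_lt_sub_right (hF.lt_add_smul_one hT hc) c
  continuous_add_smul_one T := (hF.continuous_add_smul_one T).sub continuous_const

protected theorem dualOperator (hF : IsElliptic F) : IsElliptic (dualOperator F) where
  mono {S T} hS hT h := by
    refine neg_le_neg (hF.mono (isSymmetric_neg hT) (isSymmetric_neg hS) ?_)
    rwa [ContinuousLinearMap.le_def, neg_sub_neg, ← ContinuousLinearMap.le_def]
  lt_add_smul_one {T c} hT hc := by
    have := hF.lt_add_smul_one (isSymmetric_neg (isSymmetric_add_smul_one hT c)) hc
    rw [neg_add, neg_add_cancel_right, ← neg_add] at this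
    exact neg_lt_neg this
  continuous_add_smul_one T := by
    have := ((hF.continuous_add_smul_one (-T)).comp continuous_neg).neg
    convert this using 2 with c
    simp [dualOperator, add_comm]

theorem nontrivial (hF : IsElliptic F) : Nontrivial E := by
  by_contra h
  rw [not_nontrivial_iff_subsingleton] at h
  exact (hF.lt_add_smul_one (T := 0) .zero one_pos).ne (congrArg F (Subsingleton.elim _ _))

theorem nonneg_of_forall_pos (hF : IsElliptic F) {T : E →L[ℝ] E}
    (h : ∀ ε : ℝ, 0 < ε → 0 ≤ F (T + ε • 1)) : 0 ≤ F T := by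
  have : Tendsto (fun c : ℝ => F (T + c • 1)) (𝓝[>] 0) (𝓝 (F T)) :=
    ((hF.continuous_add_smul_one T).tendsto' 0 _ (by simp)).mono_left nhdsWithin_le_nhds
  exact ge_of_tendsto this (eventually_mem_nhdsWithin.mono fun ε hε => h ε hε)

end IsElliptic

end Elliptic

section Phase

variable {E : Type*} [NormedAddCommGroup E] [InnerProductSpace ℝ E]
  [FiniteDimensional ℝ E]

/-- The sum of the arctangents of the eigenvalues of an operator, counted with multiplicity: the
coordinate-free form of `lagrangianPhase`. -/
noncomputable def operatorPhase (T : E →L[ℝ] E) : ℝ :=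
  ((T : E →ₗ[ℝ] E).charpoly.roots.map Real.arctan).sum

theorem operatorPhase_eq_sum {n : ℕ} {T : E →L[ℝ] E} (hT : T.IsSymmetric)
    (hn : Module.finrank ℝ E = n) :
    operatorPhase T = ∑ i, Real.arctan (hT.eigenvalues hn i) := by
  rw [operatorPhase, hT.roots_charpoly_eq_eigenvalues hn, Multiset.map_map]
  rfl

theorem operatorPhase_add_smul_one (T : E →L[ℝ] E) (c : ℝ) :
    operatorPhase (T + c • 1) =
      ((T : E →ₗ[ℝ] E).charpoly.roots.map fun l => Real.arctan (l + c)).sum := by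
  have h : ((T + c • 1 : E →L[ℝ] E) : E →ₗ[ℝ] E)
      = (T : E →ₗ[ℝ] E) - (-c) • (1 : Module.End ℝ E) := by
    ext x; simp
  rw [operatorPhase, h, LinearMap.charpoly_sub_smul,
    ← one_mul Polynomial.X, ← Polynomial.C_1, Polynomial.roots_comp_C_mul_X_add_C _ _ _ isUnit_one]
  simp [Multiset.map_map]

theorem operatorPhase_smul_one (c : ℝ) :
    operatorPhase (c • 1 : E →L[ℝ] E) = Module.finrank ℝ E * Real.arctan c := by
  simpa [Multiset.map_nsmul, Multiset.sum_nsmul] using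
    operatorPhase_add_smul_one (0 : E →L[ℝ] E) c

theorem isElliptic_operatorPhase [Nontrivial E] :
    IsElliptic (operatorPhase : (E →L[ℝ] E) → ℝ) where
  mono {S T} hS hT h := by
    rw [operatorPhase_eq_sum hS rfl, operatorPhase_eq_sum hT rfl]
    exact Finset.sum_le_sum fun i _ => Real.arctan_mono
      (eigenvalues_le_eigenvalues_of_le hS hT rfl (ContinuousLinearMap.coe_le_coe_iff S T |>.2 h) i)
  lt_add_smul_one {T c} hT hc := by
    have : NeZero (Module.finrank ℝ E) := ⟨Module.finrank_pos.ne'⟩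
    rw [operatorPhase_add_smul_one, operatorPhase, hT.roots_charpoly_eq_eigenvalues rfl,
      Multiset.map_map, Multiset.map_map]
    refine Finset.sum_lt_sum_of_nonempty Finset.univ_nonempty fun i _ => ?_
    exact Real.arctan_strictMono (lt_add_of_pos_right _ hc)
  continuous_add_smul_one T := by
    simp_rw [operatorPhase_add_smul_one]
    exact continuous_multiset_sum _ fun l _ =>
      Real.continuous_arctan.comp (continuous_const_add l)

end Phase

section Semiconvex

variable {E : Type*} [NormedAddCommGroup E] [InnerProductSpace ℝ E] {f h : E → ℝ} {g g' : E → E}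
  {k k' : ℝ}

/-- `g` is a choice of generalized gradients for a `k`-semiconvex function `f`: at each point `x`
the paraboloid of opening `-k` with slope `g x` touches `f` from below. -/
def IsSemiconvexGradient (k : ℝ) (f : E → ℝ) (g : E → E) : Prop :=
  ∀ x z, f x + ⟪g x, z - x⟫ - k / 2 * ‖z - x‖ ^ 2 ≤ f z

/-- An affine function of slope `p` touches `f` from above at `x`. -/
def IsSupergradient (f : E → ℝ) (p x : E) : Prop :=
  ∀ z, f z ≤ f x + ⟪p, z - x⟫

theorem antitoneOn_of_forall_sub_le_sq {φ : ℝ → ℝ} {I : Set ℝ} [I.OrdConnected] {m : ℝ}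
    (h : ∀ s ∈ I, ∀ t ∈ I, s ≤ t → φ t - φ s ≤ m * (t - s) ^ 2) : AntitoneOn φ I := by
  have halved (n : ℕ) :
      ∀ s ∈ I, ∀ t ∈ I, s ≤ t → φ t - φ s ≤ m * (t - s) ^ 2 * (1 / 2) ^ n := by
    induction n with
    | zero => simpa using h
    | succ n ih =>
      intro s hs t ht hst
      have hmid : (s + t) / 2 ∈ I := I.Icc_subset hs ht ⟨by linarith, by linarith⟩
      have left := ih s hs _ hmid (by linarith)
      have right := ih _ hmid t ht (by linarith)
      calc φ t - φ s ≤ m * ((s + t) / 2 - s) ^ 2 * (1 / 2) ^ n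
            + m * (t - (s + t) / 2) ^ 2 * (1 / 2) ^ n := by linarith
        _ = m * (t - s) ^ 2 * (1 / 2) ^ (n + 1) := by ring
  intro s hs t ht hst
  have hlim : Tendsto (fun n : ℕ => m * (t - s) ^ 2 * (1 / 2 : ℝ) ^ n) atTop (𝓝 0) := by
    simpa using (tendsto_pow_atTop_nhds_zero_of_lt_one (by norm_num : (0 : ℝ) ≤ 1 / 2)
      (by norm_num)).const_mul (m * (t - s) ^ 2)
  exact sub_nonpos.1 (ge_of_tendsto' hlim fun n => halved n s hs t ht hst)

namespace IsSemiconvexGradient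

theorem add (hf : IsSemiconvexGradient k f g) (hh : IsSemiconvexGradient k' h g') :
    IsSemiconvexGradient (k + k') (f + h) (g + g') := fun x z => by
  have := add_le_add (hf x z) (hh x z)
  simp only [Pi.add_apply, inner_add_left]
  linarith

theorem convexOn (hf : IsSemiconvexGradient k f g) :
    ConvexOn ℝ univ fun x => f x + k / 2 * ‖x‖ ^ 2 := by
  have support (x z : E) :
      f x + k / 2 * ‖x‖ ^ 2 + ⟪g x + k • x, z - x⟫ ≤ f z + k / 2 * ‖z‖ ^ 2 := by
    have hz : ‖z‖ ^ 2 = ‖x‖ ^ 2 + 2 * ⟪x, z - x⟫ + ‖z - x‖ ^ 2 := by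
      rw [← norm_add_sq_real, add_sub_cancel]
    rw [hz, inner_add_left, real_inner_smul_left]
    linarith [hf x z]
  refine ⟨convex_univ, fun x _ y _ a b ha hb hab => ?_⟩
  set z := a • x + b • y with hz
  have hsum : a * ⟪g z + k • z, x - z⟫ + b * ⟪g z + k • z, y - z⟫ = 0 := by
    rw [← real_inner_smul_right, ← real_inner_smul_right, ← inner_add_right, smul_sub, smul_sub,
      sub_add_sub_comm, ← hz, ← add_smul, hab, one_smul, sub_self, inner_zero_right]
  have hx := mul_le_mul_of_nonneg_left (support z x) ha
  have hy := mul_le_mul_of_nonneg_left (support z y) hb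
  simp only [smul_eq_mul]
  linear_combination hx + hy - hsum - (f z + k / 2 * ‖z‖ ^ 2) * hab

protected theorem continuous [FiniteDimensional ℝ E] (hf : IsSemiconvexGradient k f g) :
    Continuous f := by
  have hconv : Continuous fun x => f x + k / 2 * ‖x‖ ^ 2 :=
    continuousOn_univ.1 (hf.convexOn.continuousOn isOpen_univ)
  refine (hconv.sub (g := fun x => k / 2 * ‖x‖ ^ 2) (by fun_prop)).congr fun x => ?_
  exact add_sub_cancel_right _ _

theorem eq_of_isSupergradient {x p : E} (hf : IsSemiconvexGradient k f g)
    (hp : IsSupergradient f p x) : g x = p := by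
  rw [← sub_eq_zero, ← norm_eq_zero, ← sq_eq_zero_iff]
  set e := g x - p with he
  have hmax : IsLocalMax (fun t : ℝ => t * ‖e‖ ^ 2 - k / 2 * ‖e‖ ^ 2 * t ^ 2) 0 := by
    refine Eventually.of_forall fun t => ?_
    have hlow := hf x (x + t • e)
    have hupp := hp (x + t • e)
    rw [add_sub_cancel_left, real_inner_smul_right] at hlow hupp
    rw [norm_smul, mul_pow, Real.norm_eq_abs, sq_abs] at hlow
    have : ‖e‖ ^ 2 = ⟪g x, e⟫ - ⟪p, e⟫ := by
      rw [← inner_sub_left, ← he, real_inner_self_eq_norm_sq]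
    linear_combination hlow + hupp + t * this
  refine hmax.hasDerivAt_eq_zero ?_
  simpa using ((hasDerivAt_id (0 : ℝ)).mul_const (‖e‖ ^ 2)).fun_sub
    (((hasDerivAt_id (0 : ℝ)).pow 2).const_mul (k / 2 * ‖e‖ ^ 2))

theorem le_quadratic_of_isSupergradient_add {x p : E} (hf : IsSemiconvexGradient k f g)
    (hh : IsSemiconvexGradient k' h g') (hp : IsSupergradient (f + h) p x) (z : E) :
    f z ≤ f x + ⟪g x, z - x⟫ + k' / 2 * ‖z - x‖ ^ 2 := by
  have hgrad : ⟪g x, z - x⟫ + ⟪g' x, z - x⟫ = ⟪p, z - x⟫ := by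
    rw [← inner_add_left, ← (hf.add hh).eq_of_isSupergradient hp, Pi.add_apply]
  have := hp z
  simp only [Pi.add_apply] at this
  linarith [hh x z]

theorem norm_sub_le_of_isSupergradient_add {x p : E} (hf : IsSemiconvexGradient k f g)
    (hh : IsSemiconvexGradient k h g') (hk : 0 < k) (hp : IsSupergradient (f + h) p x) (y : E) :
    ‖g y - g x‖ ≤ 3 * k * ‖y - x‖ := by
  set e := g y - g x with he
  have key (w : E) : ⟪e, w⟫ ≤ 3 * k / 2 * (‖y - x‖ ^ 2 + ‖w‖ ^ 2) := by
    have hxz := le_quadratic_of_isSupergradient_add hf hh hp (y + w)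
    have hyz := hf y (y + w)
    have hyx := hf x y
    have hpar : ‖y - x + w‖ ^ 2 ≤ 2 * (‖y - x‖ ^ 2 + ‖w‖ ^ 2) := by
      have := parallelogram_law_with_norm ℝ (y - x) w
      nlinarith [sq_nonneg ‖y - x - w‖]
    rw [add_sub_right_comm, inner_add_right] at hxz
    rw [add_sub_cancel_left] at hyz
    rw [he, inner_sub_left]
    linear_combination hxz + hyz + hyx + k / 2 * hpar
  have hw := key ((3 * k)⁻¹ • e)
  rw [real_inner_smul_right, real_inner_self_eq_norm_sq, norm_smul, mul_pow,
    Real.norm_of_nonneg (by positivity)] at hw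
  refine le_of_sq_le_sq ?_ (by positivity)
  field_simp at hw
  linarith

theorem apply_add_smul_sub_le (hf : IsSemiconvexGradient k f g) (x d : E) (s t : ℝ) :
    f (x + t • d) - f (x + s • d) ≤
      (t - s) * ⟪g (x + t • d), d⟫ + k / 2 * ‖d‖ ^ 2 * (t - s) ^ 2 := by
  have := hf (x + t • d) (x + s • d)
  rw [add_sub_add_left_eq_sub, ← sub_smul, real_inner_smul_right, norm_smul, mul_pow,
    Real.norm_eq_abs, sq_abs] at this
  linear_combination this

theorem expansion_of_hasFDerivAt (hf : IsSemiconvexGradient k f g) {x : E} {M : E →L[ℝ] E}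
    (hM : HasFDerivAt g M x) {ε : ℝ} (hε : 0 < ε) :
    ∀ᶠ d in 𝓝 (0 : E), |f (x + d) - (f x + ⟪g x, d⟫ + 1 / 2 * ⟪M d, d⟫)| ≤ ε * ‖d‖ ^ 2 := by
  obtain ⟨ρ, hρ, hball⟩ := Metric.eventually_nhds_iff_ball.1
    ((hasFDerivAt_iff_isLittleO_nhds_zero.1 hM).def hε)
  refine Metric.eventually_nhds_iff_ball.2 ⟨ρ, hρ, fun d hd => ?_⟩
  have slope {t : ℝ} (ht : t ∈ Icc (0 : ℝ) 1) :
      |⟪g (x + t • d), d⟫ - ⟪g x, d⟫ - t * ⟪M d, d⟫| ≤ ε * ‖d‖ ^ 2 := by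
    have hn : ‖t • d‖ ≤ ‖d‖ := by
      rw [norm_smul, Real.norm_of_nonneg ht.1]
      exact mul_le_of_le_one_left (norm_nonneg _) ht.2
    have hmem : t • d ∈ Metric.ball (0 : E) ρ := by
      rw [mem_ball_zero_iff] at hd ⊢
      exact hn.trans_lt hd
    calc |⟪g (x + t • d), d⟫ - ⟪g x, d⟫ - t * ⟪M d, d⟫|
        = |⟪g (x + t • d) - g x - M (t • d), d⟫| := by
          rw [inner_sub_left, inner_sub_left, map_smul, real_inner_smul_left]
      _ ≤ ‖g (x + t • d) - g x - M (t • d)‖ * ‖d‖ := abs_real_inner_le_norm _ _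
      _ ≤ ε * ‖d‖ * ‖d‖ := by gcongr; exact (hball _ hmem).trans (by gcongr)
      _ = ε * ‖d‖ ^ 2 := by ring
  have upper := antitoneOn_of_forall_sub_le_sq (I := Icc (0 : ℝ) 1)
    (φ := fun t => f (x + t • d) - t * ⟪g x, d⟫ - t ^ 2 / 2 * ⟪M d, d⟫ - t * (ε * ‖d‖ ^ 2))
    (m := k / 2 * ‖d‖ ^ 2 + ⟪M d, d⟫ / 2) fun s _ t ht hst => by
      linear_combination hf.apply_add_smul_sub_le x d s t +
        mul_le_mul_of_nonneg_left (abs_le.1 (slope ht)).2 (sub_nonneg.2 hst)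
  have lower := antitoneOn_of_forall_sub_le_sq (I := Icc (0 : ℝ) 1)
    (φ := fun t => -f (x + t • d) + t * ⟪g x, d⟫ + t ^ 2 / 2 * ⟪M d, d⟫ - t * (ε * ‖d‖ ^ 2))
    (m := k / 2 * ‖d‖ ^ 2 + ⟪M d, d⟫ / 2) fun s hs t _ hst => by
      linear_combination hf.apply_add_smul_sub_le x d t s +
        mul_le_mul_of_nonneg_left (abs_le.1 (slope hs)).1 (sub_nonneg.2 hst)
  have upper₁ := upper (left_mem_Icc.2 zero_le_one) (right_mem_Icc.2 zero_le_one) zero_le_one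
  have lower₁ := lower (left_mem_Icc.2 zero_le_one) (right_mem_Icc.2 zero_le_one) zero_le_one
  simp only [one_smul, zero_smul, add_zero] at upper₁ lower₁
  rw [abs_le]
  constructor <;> linarith

theorem inner_nonpos_of_isSupergradient (hf : IsSemiconvexGradient k f g) {x p : E}
    (hp : IsSupergradient f p x) {M : E →L[ℝ] E} (hM : HasFDerivAt g M x) (d : E) :
    ⟪M d, d⟫ ≤ 0 := by
  have bound {ε : ℝ} (hε : 0 < ε) : ⟪M d, d⟫ ≤ 2 * ‖d‖ ^ 2 * ε := by
    have hline : Tendsto (fun t : ℝ => t • d) (𝓝[>] 0) (𝓝 0) :=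
      ((continuous_id.smul continuous_const).tendsto' 0 0 (zero_smul ℝ d)).mono_left
        nhdsWithin_le_nhds
    obtain ⟨t, ht, ht₀⟩ := ((hline.eventually (hf.expansion_of_hasFDerivAt hM hε)).and
      self_mem_nhdsWithin).exists
    have htop := hp (x + t • d)
    have hexp := (abs_le.1 ht).1
    simp only [← hf.eq_of_isSupergradient hp, add_sub_cancel_left, map_smul,
      real_inner_smul_left, real_inner_smul_right, norm_smul, mul_pow, Real.norm_eq_abs,
      sq_abs] at htop hexp
    refine le_of_mul_le_mul_left ?_ (sq_pos_of_pos ht₀)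
    linear_combination 2 * htop + 2 * hexp
  have hlim : Tendsto (fun ε : ℝ => 2 * ‖d‖ ^ 2 * ε) (𝓝[>] 0) (𝓝 0) :=
    ((continuous_const_mul _).tendsto' 0 0 (mul_zero _)).mono_left nhdsWithin_le_nhds
  exact ge_of_tendsto hlim (eventually_mem_nhdsWithin.mono fun ε hε => bound hε)

end IsSemiconvexGradient

end Semiconvex

section Contact

open MeasureTheory Measure
open scoped NNReal

/-- On `G` the map agrees with a Lipschitz map, up to an error controlled by the distance to `G`;
this distance is minimal on `G`, hence has derivative zero almost everywhere there. -/
theorem ae_differentiableAt_of_forall_dist_le {E F : Type*} [NormedAddCommGroup E]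
    [NormedSpace ℝ E] [FiniteDimensional ℝ E] [MeasurableSpace E] [BorelSpace E]
    [NormedAddCommGroup F] [NormedSpace ℝ F] [FiniteDimensional ℝ F] (μ : Measure E)
    [μ.IsAddHaarMeasure] {g : E → F} {G : Set E} {C : ℝ≥0}
    (hg : ∀ x ∈ G, ∀ y, dist (g y) (g x) ≤ C * dist y x) :
    ∀ᵐ x ∂μ, x ∈ G → DifferentiableAt ℝ g x := by
  obtain ⟨A, hA, hAg⟩ :=
    (LipschitzOnWith.of_dist_le_mul fun y _ x hx => hg x hx y :
      LipschitzOnWith C g G).extend_finite_dimension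
  filter_upwards [hA.ae_differentiableAt (μ := μ),
    (Metric.lipschitz_infDist_pt G).ae_differentiableAt (μ := μ)] with x hAx hdx hxG
  set L : ℝ := C + (lipschitzExtensionConstant F * C : ℝ≥0) + 1 with hL
  have error (z : E) : ‖g z - A z‖ ≤ L * Metric.infDist z G := by
    rw [← div_le_iff₀' (by positivity), Metric.le_infDist ⟨x, hxG⟩]
    intro y hy
    rw [div_le_iff₀' (by positivity), ← dist_eq_norm]
    calc dist (g z) (A z) ≤ dist (g z) (g y) + dist (A y) (A z) := by
          rw [← hAg hy]; exact dist_triangle _ _ _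
      _ ≤ C * dist z y + (lipschitzExtensionConstant F * C : ℝ≥0) * dist z y :=
          add_le_add (hg y hy z) (dist_comm z y ▸ hA.dist_le_mul y z)
      _ ≤ L * dist z y := by rw [hL]; nlinarith [dist_nonneg (x := z) (y := y)]
  have hd : (fun z => Metric.infDist z G) =o[𝓝 x] fun z => z - x := by
    have hmin : IsLocalMin (fun z => Metric.infDist z G) x := Eventually.of_forall fun z => by
      simpa [Metric.infDist_zero_of_mem hxG] using Metric.infDist_nonneg
    simpa [hmin.fderiv_eq_zero, Metric.infDist_zero_of_mem hxG] using hdx.hasFDerivAt.isLittleO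
  have herror : HasFDerivAt (g - A) (0 : E →L[ℝ] F) x := by
    have hO : (g - A) =O[𝓝 x] fun z => Metric.infDist z G :=
      .of_bound L (Eventually.of_forall fun z => by
        simpa [abs_of_nonneg Metric.infDist_nonneg] using error z)
    simpa [hasFDerivAt_iff_isLittleO, hAg hxG] using! hO.trans_isLittleO hd
  simpa using herror.differentiableAt.add hAx

variable {E : Type*} [NormedAddCommGroup E] [InnerProductSpace ℝ E] [FiniteDimensional ℝ E]
  {f h : E → ℝ} {g g' : E → E} {k η : ℝ}

/-- Jensen's lemma. The contact set has positive measure because `g + g'` is Lipschitz on it and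
maps it onto the ball. -/
theorem exists_isSupergradient_differentiableAt
    (hf : IsSemiconvexGradient k f g) (hh : IsSemiconvexGradient k h g') (hk : 0 < k) (hη : 0 < η)
    (hsurj : ∀ p ∈ Metric.ball (0 : E) η, ∃ x, IsSupergradient (f + h) p x) :
    ∃ p ∈ Metric.ball (0 : E) η, ∃ x, IsSupergradient (f + h) p x ∧
      DifferentiableAt ℝ g x ∧ DifferentiableAt ℝ g' x := by
  let _ : MeasurableSpace E := borel E
  have _ : BorelSpace E := ⟨rfl⟩
  set G : Set E := {x | ∃ p ∈ Metric.ball (0 : E) η, IsSupergradient (f + h) p x}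
  lift k to ℝ≥0 using hk.le
  have hg : ∀ x ∈ G, ∀ y, dist (g y) (g x) ≤ (3 * k : ℝ≥0) * dist y x := by
    rintro x ⟨p, -, hp⟩ y
    simpa [dist_eq_norm] using hf.norm_sub_le_of_isSupergradient_add hh hk hp y
  have hg' : ∀ x ∈ G, ∀ y, dist (g' y) (g' x) ≤ (3 * k : ℝ≥0) * dist y x := by
    rintro x ⟨p, -, hp⟩ y
    simpa [dist_eq_norm] using
      hh.norm_sub_le_of_isSupergradient_add hf hk (add_comm f h ▸ hp) y
  set μ : Measure E := μH[Module.finrank ℝ E]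
  have hpos : μ G ≠ 0 := fun hG => by
    have hlip : LipschitzOnWith (3 * k + 3 * k) (g + g') G :=
      (LipschitzOnWith.of_dist_le_mul fun y _ x hx => hg x hx y).add
        (.of_dist_le_mul fun y _ x hx => hg' x hx y)
    have himage : Metric.ball (0 : E) η ⊆ (g + g') '' G := fun p hp =>
      let ⟨x, hx⟩ := hsurj p hp
      ⟨x, ⟨p, hp, hx⟩, (hf.add hh).eq_of_isSupergradient hx⟩
    have hnull := hlip.hausdorffMeasure_image_le (Nat.cast_nonneg (Module.finrank ℝ E))
    rw [show μH[Module.finrank ℝ E] G = 0 from hG, mul_zero] at hnull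
    exact (Metric.measure_ball_pos μ 0 hη).not_ge ((measure_mono himage).trans hnull)
  obtain ⟨x, ⟨p, hp, hpx⟩, hx⟩ := exists_mem_of_measure_ne_zero_of_ae hpos
    (ae_restrict_of_ae ((ae_differentiableAt_of_forall_dist_le μ hg).and
      (ae_differentiableAt_of_forall_dist_le μ hg')))
  exact ⟨p, hp, x, hpx, hx.1 ⟨p, hp, hpx⟩, hx.2 ⟨p, hp, hpx⟩⟩

end Contact

section Jets

variable {E : Type*} [NormedAddCommGroup E] [InnerProductSpace ℝ E] {u : E → ℝ} {x b : E}
  {S T : E →L[ℝ] E}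

/-- The polynomial with value `c`, gradient `b` and Hessian `T` at `x`; the last is only right for
symmetric `T`. -/
noncomputable def quadraticAt (x : E) (c : ℝ) (b : E) (T : E →L[ℝ] E) (y : E) : ℝ :=
  c + ⟪b, y - x⟫ + 1 / 2 * ⟪T (y - x), y - x⟫

theorem quadraticAt_add_smul_one (c : ℝ) (ε : ℝ) (y : E) :
    quadraticAt x c b (T + ε • 1) y = quadraticAt x c b T y + ε / 2 * ‖y - x‖ ^ 2 := by
  simp only [quadraticAt, add_apply, smul_apply, one_apply_eq_self, inner_add_left,
    real_inner_smul_left, real_inner_self_eq_norm_sq]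
  ring

/-- `(b, T)` is a second order superjet of `u` at `x`: the quadratic polynomial with this gradient
and Hessian touches `u` from above at `x`. -/
def IsSuperjet (u : E → ℝ) (x b : E) (T : E →L[ℝ] E) : Prop :=
  ∀ᶠ y in 𝓝 x, u y ≤ quadraticAt x (u x) b T y

theorem IsSuperjet.mono (h : IsSuperjet u x b S) (hST : ∀ d, ⟪S d, d⟫ ≤ ⟪T d, d⟫) :
    IsSuperjet u x b T :=
  Eventually.mono h fun y hy => hy.trans (by simpa [quadraticAt] using hST (y - x))

end Jets

section SupConvolution

variable {E : Type*} [NormedAddCommGroup E] {K : Set E} {U V f h : E → ℝ} {y y' : E → E} {k : ℝ}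

/-- `f` is the sup-convolution `f x = sup_{z ∈ K} (U z - k/2 ‖z - x‖²)` of `U`, the supremum being
attained at `z = y x`. -/
structure IsSupConvolution (K : Set E) (U : E → ℝ) (k : ℝ) (f : E → ℝ) (y : E → E) : Prop where
  mem : ∀ x, y x ∈ K
  eq : ∀ x, f x = U (y x) - k / 2 * ‖y x - x‖ ^ 2
  le : ∀ x, ∀ z ∈ K, U z - k / 2 * ‖z - x‖ ^ 2 ≤ f x

theorem exists_isSupConvolution (hK : IsCompact K) (hne : K.Nonempty)
    (hU : UpperSemicontinuousOn U K) (k : ℝ) : ∃ f y, IsSupConvolution K U k f y := by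
  have hmax (x : E) : ∃ y ∈ K, ∀ z ∈ K, U z - k / 2 * ‖z - x‖ ^ 2 ≤ U y - k / 2 * ‖y - x‖ ^ 2 := by
    have hcont : Continuous fun z : E => -(k / 2 * ‖z - x‖ ^ 2) := by fun_prop
    obtain ⟨y, hy, hmax⟩ :=
      (hU.add (hcont.upperSemicontinuous.upperSemicontinuousOn K)).exists_isMaxOn hne hK
    exact ⟨y, hy, fun z hz => by simpa only [← sub_eq_add_neg] using isMaxOn_iff.1 hmax z hz⟩
  choose y hyK hy using hmax
  exact ⟨fun x => U (y x) - k / 2 * ‖y x - x‖ ^ 2, y, hyK, fun _ => rfl, hy⟩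

namespace IsSupConvolution

theorem dist_le (hf : IsSupConvolution K U k f y) {z₀ : E} {D : ℝ}
    (hD : K ⊆ Metric.closedBall z₀ D) (x : E) : dist x z₀ ≤ D + ‖y x - x‖ := by
  have := dist_triangle_left x z₀ (y x)
  rw [dist_eq_norm (y x) x] at this
  linarith [Metric.mem_closedBall.1 (hD (hf.mem x))]

variable [InnerProductSpace ℝ E] {x : E}

theorem isSemiconvexGradient (hf : IsSupConvolution K U k f y) :
    IsSemiconvexGradient k f fun x => k • (y x - x) := fun x z => by
  have hz := hf.le z (y x) (hf.mem x)
  have hnorm : ‖y x - z‖ ^ 2 = ‖y x - x‖ ^ 2 - 2 * ⟪y x - x, z - x⟫ + ‖z - x‖ ^ 2 := by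
    rw [← norm_sub_sq_real, sub_sub_sub_cancel_right]
  rw [hf.eq x, real_inner_smul_left]
  linear_combination hz + k / 2 * hnorm

theorem isSuperjet {M : E →L[ℝ] E} (hf : IsSupConvolution K U k f y) (hx : K ∈ 𝓝 (y x))
    (hM : HasFDerivAt (fun x => k • (y x - x)) M x) {ε : ℝ} (hε : 0 < ε) :
    IsSuperjet U (y x) (k • (y x - x)) (M + ε • 1) := by
  have hshift : Tendsto (fun z => z - y x) (𝓝 (y x)) (𝓝 0) :=
    (continuous_id.sub continuous_const).tendsto' _ _ (sub_self _)
  filter_upwards [hx, hshift.eventually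
    (hf.isSemiconvexGradient.expansion_of_hasFDerivAt hM (half_pos hε))] with z hzK hz
  have hle := hf.le (x + (z - y x)) z hzK
  rw [show z - (x + (z - y x)) = y x - x by abel] at hle
  rw [quadraticAt_add_smul_one, quadraticAt]
  linarith [hf.eq x, (abs_le.1 hz).2]

theorem add_penalty_le (hf : IsSupConvolution K U k f y) (hh : IsSupConvolution K V k h y')
    (hk : 1 ≤ k) {z₀ p : E} (hz₀ : z₀ ∈ K) {D η : ℝ} (hD : K ⊆ Metric.closedBall z₀ D)
    (hη : η ≤ 1) (hp : ‖p‖ ≤ η) (hx : f z₀ + h z₀ + ⟪p, x - z₀⟫ ≤ f x + h x) :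
    U z₀ + V z₀ + k / 4 * (‖y x - x‖ ^ 2 + ‖y' x - x‖ ^ 2) ≤
      U (y x) + V (y' x) + η * (D + 1) := by
  have hinner : -⟪p, x - z₀⟫ ≤ η * (D + ‖y x - x‖) := by
    rw [← inner_neg_right, neg_sub]
    refine (real_inner_le_norm _ _).trans
      (mul_le_mul hp ?_ (norm_nonneg _) ((norm_nonneg p).trans hp))
    rw [← dist_eq_norm']
    exact hf.dist_le hD x
  have hη' : η * ‖y x - x‖ ≤ η + ‖y x - x‖ ^ 2 / 4 := by
    nlinarith [sq_nonneg (‖y x - x‖ - 2 * η), (norm_nonneg p).trans hp]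
  have hfz := hf.le z₀ z₀ hz₀
  have hhz := hh.le z₀ z₀ hz₀
  rw [sub_self, norm_zero] at hfz hhz
  have := mul_le_mul_of_nonneg_right hk (sq_nonneg ‖y x - x‖)
  have := mul_nonneg (zero_le_one.trans hk) (sq_nonneg ‖y' x - x‖)
  linarith [hf.eq x, hh.eq x]

/-- At a point where the penalized sum `f + h - ⟪p, ·⟫` is at least as large as at `z₀`, the
penalization is small against the gain `θ < U z₀ + V z₀` as soon as `k` is large and `p` small. -/
theorem exists_forall_dist_le (hK : IsCompact K) (hU : UpperSemicontinuousOn U K)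
    (hV : UpperSemicontinuousOn V K) {z₀ : E} (hz₀ : z₀ ∈ K) {θ r : ℝ} (hθ : θ < U z₀ + V z₀)
    (hr : 0 < r) : ∃ k > 0, ∃ η > 0, ∃ R, ∀ {f h : E → ℝ} {y y' : E → E},
      IsSupConvolution K U k f y → IsSupConvolution K V k h y' →
      ∀ p ∈ Metric.ball (0 : E) η, ∀ x, f z₀ + h z₀ + ⟪p, x - z₀⟫ ≤ f x + h x →
        dist x z₀ ≤ R ∧ dist (y x) (y' x) ≤ r ∧ θ ≤ U (y x) + V (y' x) := by
  obtain ⟨C, hC⟩ := hU.bddAbove_of_isCompact hK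
  obtain ⟨C', hC'⟩ := hV.bddAbove_of_isCompact hK
  obtain ⟨D, hD⟩ := hK.isBounded.subset_closedBall z₀
  have hD0 : 0 ≤ D := dist_nonneg.trans (hD hz₀)
  set η := min 1 ((U z₀ + V z₀ - θ) / (D + 1))
  have hη : η * (D + 1) ≤ U z₀ + V z₀ - θ :=
    (le_div_iff₀ (by positivity)).1 (min_le_right _ _)
  set k := max 1 (16 * (C + C' - θ) / r ^ 2)
  have hk : C + C' - θ ≤ k / 4 * (r / 2) ^ 2 := by
    have := (div_le_iff₀ (by positivity)).1 (le_max_right 1 (16 * (C + C' - θ) / r ^ 2))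
    linarith
  have hk1 : 1 ≤ k := le_max_left _ _
  refine ⟨k, by positivity, η, lt_min one_pos (div_pos (sub_pos.2 hθ) (by positivity)), D + r / 2,
    fun {f h y y'} hf hh p hp x hx => ?_⟩
  have hgain : θ + k / 4 * (‖y x - x‖ ^ 2 + ‖y' x - x‖ ^ 2) ≤ U (y x) + V (y' x) := by
    linarith [hf.add_penalty_le hh hk1 hz₀ hD (min_le_left _ _) (mem_ball_zero_iff.1 hp).le hx]
  have hsum : ‖y x - x‖ ^ 2 + ‖y' x - x‖ ^ 2 ≤ (r / 2) ^ 2 := by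
    refine le_of_mul_le_mul_left ?_ (show 0 < k / 4 by positivity)
    linarith [hC (mem_image_of_mem U (hf.mem x)), hC' (mem_image_of_mem V (hh.mem x))]
  have hy : ‖y x - x‖ ≤ r / 2 :=
    (sq_le_sq₀ (norm_nonneg _) (by positivity)).1 (by linarith [sq_nonneg ‖y' x - x‖])
  have hy' : ‖y' x - x‖ ≤ r / 2 :=
    (sq_le_sq₀ (norm_nonneg _) (by positivity)).1 (by linarith [sq_nonneg ‖y x - x‖])
  refine ⟨by linarith [hf.dist_le hD x], ?_, ?_⟩
  · have := dist_triangle_right (y x) (y' x) x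
    rw [dist_eq_norm (y x) x, dist_eq_norm (y' x) x] at this
    linarith
  · have : 0 ≤ k / 4 * (‖y x - x‖ ^ 2 + ‖y' x - x‖ ^ 2) := by positivity
    linarith

end IsSupConvolution

end SupConvolution

section Sums

theorem exists_pos_forall_dist_le_imp_mem {X : Type*} [MetricSpace X] {K Ω : Set X}
    (hK : IsCompact K) (hΩ : IsOpen Ω) {U V : X → ℝ} (hU : UpperSemicontinuousOn U K)
    (hV : UpperSemicontinuousOn V K) {θ : ℝ} (hbd : ∀ x ∈ K \ Ω, U x + V x < θ) :
    ∃ r > 0, ∀ y ∈ K, ∀ z ∈ K, dist y z ≤ r → θ ≤ U y + V z → y ∈ Ω ∧ z ∈ Ω := by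
  have hpairs : IsCompact ((K ×ˢ K) \ (Ω ×ˢ Ω)) := (hK.prod hK).diff (hΩ.prod hΩ)
  have husc : UpperSemicontinuousOn (fun q : X × X => U q.1 + V q.2) ((K ×ˢ K) \ (Ω ×ˢ Ω)) :=
    (hU.comp continuousOn_fst fun q hq => hq.1.1).add
      (hV.comp continuousOn_snd fun q hq => hq.1.2)
  obtain ⟨r, hr, hdist⟩ := (husc.isCompact_inter_preimage_Ici hpairs θ).exists_forall_le'
    continuous_dist.continuousOn (a := 0) <| by
      rintro ⟨y, z⟩ ⟨⟨⟨hy, -⟩, hyz⟩, hθ⟩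
      refine dist_pos.2 fun heq => ?_
      obtain rfl : y = z := heq
      exact (hbd y ⟨hy, fun hyΩ => hyz ⟨hyΩ, hyΩ⟩⟩).not_ge hθ
  refine ⟨r / 2, half_pos hr, fun y hy z hz hyz hθ => ?_⟩
  by_contra hmem
  linarith [hdist (y, z) ⟨⟨⟨hy, hz⟩, hmem⟩, hθ⟩]

variable {E : Type*} [NormedAddCommGroup E] [InnerProductSpace ℝ E]

theorem inner_selfAdjointPart_apply_self [CompleteSpace E] (M : E →L[ℝ] E) (d : E) :
    ⟪(selfAdjointPart ℝ M : E →L[ℝ] E) d, d⟫ = ⟪M d, d⟫ := by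
  rw [selfAdjointPart_apply_coe, smul_apply, add_apply, real_inner_smul_left, inner_add_left,
    ContinuousLinearMap.star_eq_adjoint, ContinuousLinearMap.adjoint_inner_left,
    real_inner_comm (M d) d, ← two_mul, invOf_mul_cancel_left]

theorem IsSuperjet.selfAdjointPart_add [CompleteSpace E] {U : E → ℝ} {x b : E} {M : E →L[ℝ] E}
    {ε : ℝ} (h : IsSuperjet U x b (M + ε • 1)) :
    IsSuperjet U x b ((selfAdjointPart ℝ M : E →L[ℝ] E) + ε • 1) :=
  h.mono fun d => by
    rw [add_apply, add_apply, inner_add_left, inner_add_left, inner_selfAdjointPart_apply_self]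

theorem exists_isSupergradient_of_dist_le [FiniteDimensional ℝ E] {f : E → ℝ} (hf : Continuous f)
    {p z₀ : E} {R : ℝ} (hR : ∀ x, f z₀ + ⟪p, x - z₀⟫ ≤ f x → dist x z₀ ≤ R) :
    ∃ x, IsSupergradient f p x := by
  have := FiniteDimensional.proper ℝ E
  obtain ⟨x, hx⟩ := Continuous.exists_forall_ge' (f := fun x => f x - ⟪p, x⟫) (by fun_prop) z₀ <| by
    filter_upwards [(isCompact_closedBall z₀ R).compl_mem_cocompact] with x hx
    by_contra! hlt
    exact hx (hR x (by rw [inner_sub_right]; linarith))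
  exact ⟨x, fun z => by rw [inner_sub_right]; linarith [hx z]⟩

/-- The theorem on sums. Sup-convolution makes `U` and `V` semiconvex, and Jensen's lemma then finds
a point of contact at which both are twice differentiable. -/
theorem exists_isSuperjet_add_nonpos [FiniteDimensional ℝ E] {K Ω : Set E} (hK : IsCompact K)
    (hΩ : IsOpen Ω) (hΩK : Ω ⊆ K) {U V : E → ℝ} (hU : UpperSemicontinuousOn U K)
    (hV : UpperSemicontinuousOn V K) {z₀ : E} (hz₀ : z₀ ∈ K) {θ : ℝ}
    (hbd : ∀ x ∈ K \ Ω, U x + V x < θ) (hθ : θ < U z₀ + V z₀) :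
    ∃ x ∈ Ω, ∃ y ∈ Ω, ∃ b c : E, ∃ A B : E →L[ℝ] E, A.IsSymmetric ∧ B.IsSymmetric ∧
      (∀ ε : ℝ, 0 < ε → IsSuperjet U x b (A + ε • 1)) ∧
      (∀ ε : ℝ, 0 < ε → IsSuperjet V y c (B + ε • 1)) ∧ A ≤ -B := by
  have := FiniteDimensional.complete ℝ E
  obtain ⟨r, hr, hΩr⟩ := exists_pos_forall_dist_le_imp_mem hK hΩ hU hV hbd
  obtain ⟨k, hk, η, hη, R, hR⟩ :=
    IsSupConvolution.exists_forall_dist_le hK hU hV hz₀ hθ hr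
  obtain ⟨f, y, hf⟩ := exists_isSupConvolution hK ⟨z₀, hz₀⟩ hU k
  obtain ⟨h, y', hh⟩ := exists_isSupConvolution hK ⟨z₀, hz₀⟩ hV k
  have hf' := hf.isSemiconvexGradient
  have hh' := hh.isSemiconvexGradient
  obtain ⟨p, hp, x, hx, hdiff, hdiff'⟩ :=
    exists_isSupergradient_differentiableAt hf' hh' hk hη fun p hp =>
      exists_isSupergradient_of_dist_le (hf'.add hh').continuous fun x hx => (hR hf hh p hp x hx).1
  have hxz₀ : f z₀ + h z₀ + ⟪p, x - z₀⟫ ≤ f x + h x := by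
    have := hx z₀
    rw [← neg_sub x, inner_neg_right, Pi.add_apply, Pi.add_apply] at this
    linarith
  obtain ⟨-, hdist, hlevel⟩ := hR hf hh p hp x hxz₀
  obtain ⟨hyΩ, hyΩ'⟩ := hΩr _ (hf.mem x) _ (hh.mem x) hdist hlevel
  obtain ⟨M, hM⟩ := hdiff
  obtain ⟨N, hN⟩ := hdiff'
  have hA := (selfAdjointPart ℝ M).2.isSymmetric
  have hB := (selfAdjointPart ℝ N).2.isSymmetric
  refine ⟨y x, hyΩ, y' x, hyΩ', _, _, selfAdjointPart ℝ M, selfAdjointPart ℝ N, hA, hB,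
    fun ε hε =>
      (hf.isSuperjet (mem_of_superset (hΩ.mem_nhds hyΩ) hΩK) hM hε).selfAdjointPart_add,
    fun ε hε =>
      (hh.isSuperjet (mem_of_superset (hΩ.mem_nhds hyΩ') hΩK) hN hε).selfAdjointPart_add,
    (le_iff_forall_inner_le hA (isSymmetric_neg hB)).2 fun d => ?_⟩
  have := (hf'.add hh').inner_nonpos_of_isSupergradient hx (hM.add hN) d
  rw [add_apply, inner_add_left] at this
  rw [neg_apply, inner_neg_left, inner_selfAdjointPart_apply_self,
    inner_selfAdjointPart_apply_self]
  linarith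

end Sums

section Comparison

variable {E : Type*} [NormedAddCommGroup E] [InnerProductSpace ℝ E] {F : (E →L[ℝ] E) → ℝ}
  {Ω : Set E} {u v : E → ℝ} {x b : E} {T : E →L[ℝ] E}

/-- `F (D²u) ≥ 0` in `Ω` in the viscosity sense, tested with quadratic polynomials. The inequality
`F (D²u) ≤ 0` is `IsJetSubsolution (dualOperator F) Ω (-u)`. -/
def IsJetSubsolution (F : (E →L[ℝ] E) → ℝ) (Ω : Set E) (u : E → ℝ) : Prop :=
  ∀ x ∈ Ω, ∀ (b : E) (T : E →L[ℝ] E), T.IsSymmetric → IsSuperjet u x b T → 0 ≤ F T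

theorem IsSuperjet.of_eventually_le (h : IsSuperjet u x b T) (hle : ∀ᶠ y in 𝓝 x, v y ≤ u y)
    (heq : v x = u x) : IsSuperjet v x b T := by
  filter_upwards [h, hle] with y hy hvu
  exact heq ▸ hvu.trans hy

theorem IsJetSubsolution.congr (hu : IsJetSubsolution F Ω u) (hΩ : IsOpen Ω) (h : EqOn u v Ω) :
    IsJetSubsolution F Ω v := fun x hx b T hT hj =>
  hu x hx b T hT <| hj.of_eventually_le
    (eventually_of_mem (hΩ.mem_nhds hx) fun _ hy => (h hy).le) (h hx)

theorem IsSuperjet.of_add_norm_sq {δ : ℝ}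
    (h : IsSuperjet (fun y => u y + δ / 2 * ‖y‖ ^ 2) x b T) :
    IsSuperjet u x (b - δ • x) (T + (-δ) • 1) := by
  filter_upwards [h] with y hy
  have hnorm : ‖y‖ ^ 2 = ‖x‖ ^ 2 + 2 * ⟪x, y - x⟫ + ‖y - x‖ ^ 2 := by
    rw [← norm_add_sq_real, add_sub_cancel]
  rw [quadraticAt_add_smul_one]
  simp only [quadraticAt, inner_sub_left, real_inner_smul_left] at hy ⊢
  linear_combination hy - δ / 2 * hnorm

theorem IsJetSubsolution.add_nonpos [FiniteDimensional ℝ E] (hF : IsElliptic F) (hΩ : IsOpen Ω)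
    (hb : Bornology.IsBounded Ω) (husc : UpperSemicontinuousOn u (closure Ω))
    (hvsc : UpperSemicontinuousOn v (closure Ω)) (hu : IsJetSubsolution F Ω u)
    (hv : IsJetSubsolution (dualOperator F) Ω v) (hbd : ∀ x ∈ frontier Ω, u x + v x ≤ 0) :
    ∀ x ∈ closure Ω, u x + v x ≤ 0 := by
  by_contra! ⟨z₀, hz₀, hpos⟩
  have := FiniteDimensional.proper ℝ E
  have hK : IsCompact (closure Ω) := hb.isCompact_closure
  obtain ⟨R, hR, hRK⟩ := hK.isBounded.exists_pos_norm_le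
  set θ := u z₀ + v z₀
  set δ := θ / R ^ 2
  have hδ : 0 < δ := by positivity
  have hδR : δ * R ^ 2 = θ := div_mul_cancel₀ _ (by positivity)
  have hδusc : UpperSemicontinuousOn (fun x => u x + δ / 2 * ‖x‖ ^ 2) (closure Ω) :=
    husc.add ((by fun_prop : Continuous fun x : E => δ / 2 * ‖x‖ ^ 2).upperSemicontinuous
      |>.upperSemicontinuousOn _)
  have hfrontier : ∀ x ∈ closure Ω \ Ω, u x + δ / 2 * ‖x‖ ^ 2 + v x < 3 / 4 * θ := by
    intro x hx
    have hxR : ‖x‖ ^ 2 ≤ R ^ 2 := pow_le_pow_left₀ (norm_nonneg x) (hRK x hx.1) 2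
    nlinarith [hbd x (hΩ.frontier_eq ▸ hx)]
  have hinterior : 3 / 4 * θ < u z₀ + δ / 2 * ‖z₀‖ ^ 2 + v z₀ := by
    have : 0 ≤ δ / 2 * ‖z₀‖ ^ 2 := by positivity
    linarith
  obtain ⟨x, hx, y, hy, b, c, A, B, hA, hB, hJA, hJB, hAB⟩ :=
    exists_isSuperjet_add_nonpos hK hΩ subset_closure hδusc hvsc hz₀ hfrontier hinterior
  have hFA : 0 ≤ F (A + (-δ) • 1) := hF.nonneg_of_forall_pos fun ε hε => by
    rw [add_right_comm]
    exact hu x hx _ _ (isSymmetric_add_smul_one (isSymmetric_add_smul_one hA ε) (-δ))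
      (hJA ε hε).of_add_norm_sq
  have hFB : F (-B) ≤ 0 := neg_nonneg.1 <| hF.dualOperator.nonneg_of_forall_pos fun ε hε =>
    hv y hy c _ (isSymmetric_add_smul_one hB ε) (hJB ε hε)
  have hstrict := hF.lt_add_smul_one (isSymmetric_add_smul_one hA (-δ)) hδ
  rw [neg_smul, neg_add_cancel_right] at hstrict
  rw [neg_smul] at hFA
  linarith [hF.mono hA (isSymmetric_neg hB) hAB]

end Comparison

section Quadratic

variable {E : Type*} [NormedAddCommGroup E] [InnerProductSpace ℝ E] {F : (E →L[ℝ] E) → ℝ}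
  {x : E} {c : ℝ} {b : E} {T : E →L[ℝ] E}

theorem continuous_quadraticAt : Continuous (quadraticAt x c b T) := by
  unfold quadraticAt
  fun_prop

@[simp]
theorem quadraticAt_self : quadraticAt x c b T x = c := by
  simp [quadraticAt]

theorem neg_quadraticAt : -quadraticAt x c b T = quadraticAt x (-c) (-b) (-T) := by
  ext y
  simp only [quadraticAt, Pi.neg_apply, neg_apply, inner_neg_left]
  ring

theorem quadraticAt_add_smul (t : ℝ) (d : E) :
    quadraticAt x c b T (x + t • d) = c + t * ⟪b, d⟫ + t ^ 2 / 2 * ⟪T d, d⟫ := by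
  simp only [quadraticAt, add_sub_cancel_left, map_smul, real_inner_smul_left,
    real_inner_smul_right]
  ring

theorem quadraticAt_recenter (hT : T.IsSymmetric) (y : E) :
    quadraticAt x c b T = quadraticAt y (quadraticAt x c b T y) (b + T (y - x)) T := by
  ext z
  have hsymm : ⟪T (z - y), y - x⟫ = ⟪T (y - x), z - y⟫ :=
    (hT (z - y) (y - x)).trans (real_inner_comm _ _)
  have hz : z - x = (z - y) + (y - x) := (sub_add_sub_cancel z y x).symm
  simp only [quadraticAt, hz, map_add, inner_add_left, inner_add_right]
  linear_combination 1 / 2 * hsymm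

theorem isJetSubsolution_quadraticAt (hF : IsElliptic F) (Ω : Set E) (x : E) (c : ℝ) (b : E)
    (hT : T.IsSymmetric) (hFT : 0 ≤ F T) : IsJetSubsolution F Ω (quadraticAt x c b T) := by
  intro y _ b' S hS hj
  refine hFT.trans (hF.mono hT hS ((le_iff_forall_inner_le hT hS).2 fun d => ?_))
  have hline (σ : ℝ) : Tendsto (fun t : ℝ => y + (σ * t) • d) (𝓝[>] 0) (𝓝 y) :=
    ((by fun_prop : Continuous fun t : ℝ => y + (σ * t) • d).tendsto' 0 y (by simp)).mono_left
      nhdsWithin_le_nhds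
  rw [quadraticAt_recenter hT y, IsSuperjet] at hj
  obtain ⟨t, ⟨hplus, hminus⟩, ht⟩ :=
    (((hline 1).eventually hj).and ((hline (-1)).eventually hj)).and self_mem_nhdsWithin |>.exists
  simp only [quadraticAt_add_smul, quadraticAt_self] at hplus hminus
  have ht2 : 0 < t ^ 2 := pow_pos ht 2
  exact le_of_mul_le_mul_left (by linear_combination hplus + hminus) ht2

end Quadratic

section UscHull

variable {X : Type*} [TopologicalSpace X] {K : Set X} {U g : X → ℝ} {x : X}

/-- The upper semicontinuous hull on `K` of a function which is bounded above there. -/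
noncomputable def uscHull (K : Set X) (U : X → ℝ) (x : X) : ℝ :=
  limsup U (𝓝[K] x)

theorem uscHull_le_of_eventually_le {c : ℝ} (hx : x ∈ K) (h : ∀ᶠ y in 𝓝[K] x, U y ≤ c) :
    uscHull K U x ≤ c :=
  csInf_le ⟨U x, fun a (ha : ∀ᶠ y in 𝓝[K] x, U y ≤ a) => ha.self_of_nhdsWithin hx⟩ h

theorem uscHull_le_of_continuousAt (hx : x ∈ K) (hg : ContinuousAt g x)
    (h : ∀ᶠ y in 𝓝[K] x, U y ≤ g y) : uscHull K U x ≤ g x := by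
  refine le_of_forall_gt_imp_ge_of_dense fun c hc => uscHull_le_of_eventually_le hx ?_
  filter_upwards [h, nhdsWithin_le_nhds (hg.eventually_lt_const hc)] with y hUg hgc
  exact hUg.trans hgc.le

theorem exists_eventually_le_of_uscHull_lt (hU : BddAbove (U '' K)) {c : ℝ}
    (h : uscHull K U x < c) : ∃ c' < c, ∀ᶠ y in 𝓝[K] x, U y ≤ c' := by
  obtain ⟨C, hC⟩ := hU
  have hne : {a | ∀ᶠ y in 𝓝[K] x, U y ≤ a}.Nonempty :=
    ⟨C, eventually_mem_nhdsWithin.mono fun y hy => hC (mem_image_of_mem U hy)⟩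
  obtain ⟨c', hc', hlt⟩ := exists_lt_of_csInf_lt hne h
  exact ⟨c', hlt, hc'⟩

theorem le_uscHull (hU : BddAbove (U '' K)) (hx : x ∈ K) : U x ≤ uscHull K U x := by
  refine le_of_forall_gt_imp_ge_of_dense fun c hc => ?_
  obtain ⟨c', hc', hle⟩ := exists_eventually_le_of_uscHull_lt hU hc
  exact (hle.self_of_nhdsWithin hx).trans hc'.le

theorem upperSemicontinuousOn_uscHull (hU : BddAbove (U '' K)) :
    UpperSemicontinuousOn (uscHull K U) K := by
  intro x _ c hc
  obtain ⟨c', hc', hle⟩ := exists_eventually_le_of_uscHull_lt hU hc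
  filter_upwards [eventually_eventually_nhdsWithin.2 hle, self_mem_nhdsWithin] with y hy hyK
  exact (uscHull_le_of_eventually_le hyK hy).trans_lt hc'

end UscHull

section Perron

variable {E : Type*} [NormedAddCommGroup E] [InnerProductSpace ℝ E] {F : (E →L[ℝ] E) → ℝ}
  {Ω : Set E} {φ u v w q U V W : E → ℝ} {x b : E} {T : E →L[ℝ] E}

/-- In balls inside `Ω`, `U` lies below every quadratic polynomial which violates `F (D²q) ≥ 0` and
dominates `V` near the boundary of the ball. -/
def HasQuadraticComparison (F : (E →L[ℝ] E) → ℝ) (Ω : Set E) (U V : E → ℝ) : Prop :=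
  ∀ ⦃x : E⦄ ⦃ρ : ℝ⦄, 0 < ρ → Metric.closedBall x ρ ⊆ Ω →
    ∀ (c : ℝ) (b : E) ⦃T : E →L[ℝ] E⦄, T.IsSymmetric → F T < 0 →
      (∀ y ∈ Metric.closedBall x ρ \ Metric.closedBall x (ρ / 2), V y ≤ quadraticAt x c b T y) →
        ∀ y ∈ Metric.ball x ρ, U y ≤ quadraticAt x c b T y

theorem IsSuperjet.exists_forall_annulus_le (hΩ : IsOpen Ω) (hx : x ∈ Ω) (h : IsSuperjet V x b T)
    {ε : ℝ} (hε : 0 < ε) : ∃ ρ > 0, Metric.closedBall x ρ ⊆ Ω ∧ ∃ c < V x,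
      ∀ y ∈ Metric.closedBall x ρ \ Metric.closedBall x (ρ / 2),
        V y ≤ quadraticAt x c b (T + ε • 1) y := by
  obtain ⟨ρ, hρ, hball⟩ := Metric.nhds_basis_closedBall.eventually_iff.1
    ((hΩ.eventually_mem hx).and h)
  refine ⟨ρ, hρ, fun y hy => (hball hy).1, V x - ε / 2 * (ρ / 2) ^ 2,
    sub_lt_self _ (by positivity), fun y hy => ?_⟩
  have hdist : (ρ / 2) ^ 2 ≤ ‖y - x‖ ^ 2 := by
    rw [← dist_eq_norm]
    exact pow_le_pow_left₀ (by positivity) (not_le.1 hy.2).le 2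
  have hle := (hball hy.1).2
  rw [quadraticAt_add_smul_one]
  simp only [quadraticAt] at hle ⊢
  linear_combination hle + ε / 2 * hdist

theorem HasQuadraticComparison.isJetSubsolution_uscHull (hF : IsElliptic F) (hΩ : IsOpen Ω)
    (h : HasQuadraticComparison F Ω U (uscHull (closure Ω) U)) :
    IsJetSubsolution F Ω (uscHull (closure Ω) U) := by
  refine fun x hx b T hT hj => hF.nonneg_of_forall_pos fun ε hε => ?_
  by_contra! hneg
  obtain ⟨ρ, hρ, hρΩ, c, hc, hannulus⟩ := hj.exists_forall_annulus_le hΩ hx hε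
  have hU := h hρ hρΩ c b (isSymmetric_add_smul_one hT ε) hneg hannulus
  refine hc.not_ge ?_
  simpa only [quadraticAt_self] using uscHull_le_of_continuousAt (subset_closure hx)
    continuous_quadraticAt.continuousAt
    (nhdsWithin_le_nhds <| eventually_of_mem (Metric.ball_mem_nhds x hρ) hU)

theorem isJetSubsolution_neg_quadraticAt (hF : IsElliptic F) (Ω : Set E) (x : E) (c : ℝ) (b : E)
    (hT : T.IsSymmetric) (hFT : F T ≤ 0) :
    IsJetSubsolution (dualOperator F) Ω (-quadraticAt x c b T) := by
  rw [neg_quadraticAt]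
  refine isJetSubsolution_quadraticAt hF.dualOperator _ _ _ _ (isSymmetric_neg hT) ?_
  simpa [dualOperator] using hFT

theorem IsJetSubsolution.hasQuadraticComparison [FiniteDimensional ℝ E] (hF : IsElliptic F)
    (husc : UpperSemicontinuousOn u Ω) (hu : IsJetSubsolution F Ω u) (huV : ∀ y ∈ Ω, u y ≤ V y) :
    HasQuadraticComparison F Ω u V := by
  intro x ρ hρ hρΩ c b T hT hFT hV y hy
  refine add_neg_nonpos_iff.1 <| IsJetSubsolution.add_nonpos hF Metric.isOpen_ball
    Metric.isBounded_ball (husc.mono (Metric.closure_ball_subset_closedBall.trans hρΩ))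
    (continuous_quadraticAt.neg.upperSemicontinuous.upperSemicontinuousOn _)
    (fun z hz => hu z (hρΩ (Metric.ball_subset_closedBall hz)))
    (isJetSubsolution_neg_quadraticAt hF _ _ c b hT hFT.le) (fun z hz => ?_) y (subset_closure hy)
  have hzx : dist z x = ρ := Metric.frontier_ball_subset_sphere hz
  have hzρ : z ∈ Metric.closedBall x ρ := hzx.le
  have hzρ' : z ∉ Metric.closedBall x (ρ / 2) := not_le.2 ((half_lt_self hρ).trans_eq hzx.symm)
  exact add_neg_nonpos_iff.2 ((huV z (hρΩ hzρ)).trans (hV z ⟨hzρ, hzρ'⟩))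

/-- The subsolutions competing in Perron's method for the Dirichlet problem `F (D²u) = 0` in `Ω`,
`u = φ` on the boundary. -/
structure IsPerronCompetitor (F : (E →L[ℝ] E) → ℝ) (Ω : Set E) (φ w : E → ℝ) : Prop where
  usc : UpperSemicontinuousOn w (closure Ω)
  isJetSubsolution : IsJetSubsolution F Ω w
  le_frontier : ∀ x ∈ frontier Ω, w x ≤ φ x

/-- Every boundary value `φ x` is approximated by the values at `x` of continuous subsolutions
below `φ`. The barriers from above are those of `dualOperator F` for the boundary values `-φ`. -/
def HasBarriers (F : (E →L[ℝ] E) → ℝ) (Ω : Set E) (φ : E → ℝ) : Prop :=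
  ∀ x ∈ frontier Ω, ∀ ε > 0, ∃ w, Continuous w ∧ IsPerronCompetitor F Ω φ w ∧ φ x - ε ≤ w x

theorem IsPerronCompetitor.add_nonpos [FiniteDimensional ℝ E] (hF : IsElliptic F) (hΩ : IsOpen Ω)
    (hb : Bornology.IsBounded Ω) (hu : IsPerronCompetitor F Ω φ u)
    (hv : IsPerronCompetitor (dualOperator F) Ω (-φ) v) : ∀ x ∈ closure Ω, u x + v x ≤ 0 :=
  hu.isJetSubsolution.add_nonpos hF hΩ hb hu.usc hv.usc hv.isJetSubsolution fun x hx => by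
    simpa using add_le_add (hu.le_frontier x hx) (hv.le_frontier x hx)

theorem IsPerronCompetitor.exists_bump (hΩ : IsOpen Ω) (hu : IsPerronCompetitor F Ω φ u)
    (hq : Continuous q) (hqF : IsJetSubsolution F Ω q) {B C : Set E} (hB : IsOpen B)
    (hC : IsClosed C) (hCB : C ⊆ B) (hBΩ : B ⊆ Ω) (hle : ∀ y ∈ B \ C, q y ≤ u y) :
    ∃ w, IsPerronCompetitor F Ω φ w ∧ ∀ y ∈ B, q y ≤ w y := by
  classical
  set w := C.piecewise (u ⊔ q) u
  have hwC : ∀ y ∈ C, w y = u y ⊔ q y := fun _ => C.piecewise_eq_of_mem _ _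
  have hwC' : ∀ y ∉ C, w y = u y := fun _ => C.piecewise_eq_of_notMem _ _
  have huw : u ≤ w := C.le_piecewise (fun _ _ => le_sup_left) fun _ _ => le_rfl
  have hwuq : w ≤ u ⊔ q := C.piecewise_le (fun _ _ => le_rfl) fun _ _ => le_sup_left
  have hqw : ∀ y ∈ B, q y ≤ w y := fun y hy => by
    by_cases hyC : y ∈ C
    · exact hwC y hyC ▸ le_sup_right
    · exact (hle y ⟨hy, hyC⟩).trans (huw y)
  refine ⟨w, ⟨fun x hx c hc => ?_, fun x hx b T hT hj => ?_, fun x hx => ?_⟩, hqw⟩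
  · by_cases hxC : x ∈ C
    · filter_upwards [hu.usc.sup (hq.upperSemicontinuous.upperSemicontinuousOn _) x hx c
        ((hwC x hxC).symm.trans_lt hc)] with y hy using (hwuq y).trans_lt hy
    · filter_upwards [hu.usc x hx c ((hwC' x hxC).symm.trans_lt hc),
        nhdsWithin_le_nhds (hC.isOpen_compl.mem_nhds hxC)] with y hy hyC
        using (hwC' y hyC).trans_lt hy
  · by_cases hwx : w x = u x
    · exact hu.isJetSubsolution x hx b T hT
        (hj.of_eventually_le (Eventually.of_forall huw) hwx.symm)
    · have hxC : x ∈ C := not_imp_comm.1 (hwC' x) hwx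
      rw [hwC x hxC, sup_eq_left, not_le] at hwx
      exact hqF x hx b T hT (hj.of_eventually_le (eventually_of_mem (hB.mem_nhds (hCB hxC)) hqw)
        ((hwC x hxC).trans (sup_eq_right.2 hwx.le)).symm)
  · have hxC : x ∉ C := fun hxC => (hΩ.frontier_eq ▸ hx).2 (hBΩ (hCB hxC))
    exact (hwC' x hxC).trans_le (hu.le_frontier x hx)

theorem HasBarriers.exists_of_nonempty (h : HasBarriers F Ω φ) (hne : (frontier Ω).Nonempty) :
    ∃ w, Continuous w ∧ IsPerronCompetitor F Ω φ w := by
  obtain ⟨x, hx⟩ := hne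
  obtain ⟨w, hw, hwF, -⟩ := h x hx 1 one_pos
  exact ⟨w, hw, hwF⟩

theorem isPerronCompetitor_uscHull (hF : IsElliptic F) (hΩ : IsOpen Ω)
    (hφ : HasBarriers (dualOperator F) Ω (-φ)) (hbdd : BddAbove (U '' closure Ω))
    (hU : ∀ w, IsPerronCompetitor (dualOperator F) Ω (-φ) w → ∀ x ∈ closure Ω, U x + w x ≤ 0)
    (h : HasQuadraticComparison F Ω U (uscHull (closure Ω) U)) :
    IsPerronCompetitor F Ω φ (uscHull (closure Ω) U) := by
  refine ⟨upperSemicontinuousOn_uscHull hbdd, h.isJetSubsolution_uscHull hF hΩ, fun x hx => ?_⟩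
  refine le_of_forall_pos_le_add fun ε hε => ?_
  obtain ⟨w, hw, hwF, hwx⟩ := hφ x hx ε hε
  have : uscHull (closure Ω) U x ≤ -w x :=
    uscHull_le_of_continuousAt (g := -w) (frontier_subset_closure hx) hw.neg.continuousAt
      (eventually_mem_nhdsWithin.mono fun y hy => le_neg_iff_add_nonpos_right.2 (hU w hwF y hy))
  simp only [Pi.neg_apply] at hwx
  linarith

theorem IsPerronCompetitor.hasQuadraticComparison_neg_of_greatest (hF : IsElliptic F)
    (hΩ : IsOpen Ω) (hV : IsPerronCompetitor F Ω φ V)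
    (hmax : ∀ w, IsPerronCompetitor F Ω φ w → ∀ x ∈ closure Ω, w x ≤ V x)
    (hVW : ∀ x ∈ Ω, -V x ≤ W x) : HasQuadraticComparison (dualOperator F) Ω (-V) W := by
  intro x ρ hρ hρΩ c b T hT hFT hW y hy
  have hball : Metric.ball x ρ ⊆ Ω := Metric.ball_subset_closedBall.trans hρΩ
  have hle : ∀ z ∈ Metric.ball x ρ \ Metric.closedBall x (ρ / 2), -quadraticAt x c b T z ≤ V z :=
    fun z hz => neg_le.1 <| (hVW z (hball hz.1)).trans
      (hW z ⟨Metric.ball_subset_closedBall hz.1, hz.2⟩)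
  have hq := isJetSubsolution_neg_quadraticAt hF.dualOperator Ω x c b hT hFT.le
  rw [dualOperator_dualOperator] at hq
  obtain ⟨w, hw, hqw⟩ := hV.exists_bump hΩ continuous_quadraticAt.neg hq Metric.isOpen_ball
    Metric.isClosed_closedBall (Metric.closedBall_subset_ball (half_lt_self hρ)) hball hle
  exact neg_le.1 ((hqw y hy).trans (hmax w hw y (subset_closure (hball hy))))

variable [FiniteDimensional ℝ E]

theorem bddAbove_image_closure_of_add_nonpos (hb : Bornology.IsBounded Ω) (hw : Continuous w)
    (h : ∀ x ∈ closure Ω, U x + w x ≤ 0) : BddAbove (U '' closure Ω) := by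
  have := FiniteDimensional.proper ℝ E
  obtain ⟨C, hC⟩ := hb.isCompact_closure.bddAbove_image hw.neg.continuousOn
  refine ⟨C, ?_⟩
  rintro _ ⟨x, hx, rfl⟩
  exact (le_neg_iff_add_nonpos_right.2 (h x hx)).trans (hC (mem_image_of_mem _ hx))

/-- The greatest competitor is the upper semicontinuous hull of the supremum of all competitors. -/
theorem exists_greatest_isPerronCompetitor (hF : IsElliptic F) (hΩ : IsOpen Ω)
    (hb : Bornology.IsBounded Ω) (hne : (frontier Ω).Nonempty) (hlow : HasBarriers F Ω φ)
    (hupp : HasBarriers (dualOperator F) Ω (-φ)) :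
    ∃ V, IsPerronCompetitor F Ω φ V ∧
      ∀ w, IsPerronCompetitor F Ω φ w → ∀ x ∈ closure Ω, w x ≤ V x := by
  obtain ⟨w₀, -, hw₀⟩ := hlow.exists_of_nonempty hne
  obtain ⟨W₀, hW₀c, hW₀⟩ := hupp.exists_of_nonempty hne
  have : Nonempty {w // IsPerronCompetitor F Ω φ w} := ⟨w₀, hw₀⟩
  set U : E → ℝ := fun x => ⨆ w : {w // IsPerronCompetitor F Ω φ w}, w.1 x
  have hUW : ∀ W, IsPerronCompetitor (dualOperator F) Ω (-φ) W → ∀ x ∈ closure Ω, U x + W x ≤ 0 :=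
    fun W hW x hx => le_neg_iff_add_nonpos_right.1 <| ciSup_le fun w =>
      le_neg_iff_add_nonpos_right.2 (w.2.add_nonpos hF hΩ hb hW x hx)
  have hbdd : BddAbove (U '' closure Ω) :=
    bddAbove_image_closure_of_add_nonpos hb hW₀c (hUW W₀ hW₀)
  have hleU : ∀ w, IsPerronCompetitor F Ω φ w → ∀ x ∈ closure Ω, w x ≤ U x := fun w hw x hx =>
    le_ciSup (f := fun w : {w // IsPerronCompetitor F Ω φ w} => w.1 x) ⟨-W₀ x, by
      rintro _ ⟨⟨v, hv⟩, rfl⟩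
      exact le_neg_iff_add_nonpos_right.2 (hv.add_nonpos hF hΩ hb hW₀ x hx)⟩ ⟨w, hw⟩
  have hleV : ∀ w, IsPerronCompetitor F Ω φ w → ∀ x ∈ closure Ω, w x ≤ uscHull (closure Ω) U x :=
    fun w hw x hx => (hleU w hw x hx).trans (le_uscHull hbdd hx)
  refine ⟨_, isPerronCompetitor_uscHull hF hΩ hupp hbdd hUW ?_, hleV⟩
  intro x ρ hρ hρΩ c b T hT hFT hV y hy
  exact ciSup_le fun w => w.2.isJetSubsolution.hasQuadraticComparison hF
    (w.2.usc.mono subset_closure) (fun z hz => hleV w.1 w.2 z (subset_closure hz)) hρ hρΩ c b hT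
    hFT hV y hy

theorem exists_isPerronCompetitor_dualOperator_of_greatest (hF : IsElliptic F) (hΩ : IsOpen Ω)
    (hb : Bornology.IsBounded Ω) (hne : (frontier Ω).Nonempty) (hlow : HasBarriers F Ω φ)
    (hV : IsPerronCompetitor F Ω φ V)
    (hmax : ∀ w, IsPerronCompetitor F Ω φ w → ∀ x ∈ closure Ω, w x ≤ V x) :
    ∃ W, IsPerronCompetitor (dualOperator F) Ω (-φ) W ∧ ∀ x ∈ closure Ω, 0 ≤ V x + W x := by
  have hVw : ∀ w, IsPerronCompetitor F Ω φ w → ∀ x ∈ closure Ω, (-V) x + w x ≤ 0 :=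
    fun w hw x hx => neg_add_nonpos_iff.2 (hmax w hw x hx)
  obtain ⟨w₀, hw₀c, hw₀⟩ := hlow.exists_of_nonempty hne
  have hbdd : BddAbove ((-V) '' closure Ω) :=
    bddAbove_image_closure_of_add_nonpos hb hw₀c (hVw w₀ hw₀)
  refine ⟨uscHull (closure Ω) (-V), isPerronCompetitor_uscHull hF.dualOperator hΩ ?_ hbdd ?_
    (hV.hasQuadraticComparison_neg_of_greatest hF hΩ hmax fun x hx =>
      le_uscHull hbdd (subset_closure hx)),
    fun x hx => neg_le_iff_add_nonneg'.1 (le_uscHull (U := -V) hbdd hx)⟩ <;>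
  rwa [dualOperator_dualOperator, neg_neg]

theorem exists_continuousOn_isJetSubsolution (hF : IsElliptic F) (hΩ : IsOpen Ω)
    (hb : Bornology.IsBounded Ω) (hne : (frontier Ω).Nonempty) (hlow : HasBarriers F Ω φ)
    (hupp : HasBarriers (dualOperator F) Ω (-φ)) :
    ∃ u, ContinuousOn u (closure Ω) ∧ IsJetSubsolution F Ω u ∧
      IsJetSubsolution (dualOperator F) Ω (-u) ∧ EqOn u φ (frontier Ω) := by
  obtain ⟨V, hV, hmax⟩ := exists_greatest_isPerronCompetitor hF hΩ hb hne hlow hupp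
  obtain ⟨W, hW, hVW⟩ :=
    exists_isPerronCompetitor_dualOperator_of_greatest hF hΩ hb hne hlow hV hmax
  have heq : EqOn W (-V) (closure Ω) := fun x hx =>
    eq_neg_of_add_eq_zero_right ((hV.add_nonpos hF hΩ hb hW x hx).antisymm (hVW x hx))
  have hlsc : LowerSemicontinuousOn V (closure Ω) := fun x hx c hc => by
    filter_upwards [hW.usc x hx (-c) ((heq hx).trans_lt (neg_lt_neg hc)), self_mem_nhdsWithin]
      with y hy hyΩ using neg_lt_neg_iff.1 ((heq hyΩ).symm.trans_lt hy)
  refine ⟨V, continuousOn_iff_lower_upperSemicontinuousOn.2 ⟨hlsc, hV.usc⟩, hV.isJetSubsolution,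
    hW.isJetSubsolution.congr hΩ (heq.mono subset_closure), fun x hx => ?_⟩
  exact (hV.le_frontier x hx).antisymm <| neg_le_neg_iff.1 <|
    (heq (frontier_subset_closure hx)).symm.trans_le (hW.le_frontier x hx)

end Perron

section StrictlyConvex

variable {E : Type*} [NormedAddCommGroup E] [InnerProductSpace ℝ E] {F : (E →L[ℝ] E) → ℝ}
  {Ω : Set E} {φ : E → ℝ} {x₀ : E}

theorem exists_forall_inner_pos_of_strictConvex [CompleteSpace E] (hΩ : IsOpen Ω)
    (hconv : Convex ℝ Ω) (hstrict : StrictConvex ℝ (closure Ω)) (hx₀ : x₀ ∈ frontier Ω) :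
    ∃ ν : E, ∀ x ∈ closure Ω, x ≠ x₀ → 0 < ⟪ν, x - x₀⟫ := by
  obtain ⟨f, hf⟩ := geometric_hahn_banach_point_open hconv hΩ (hΩ.frontier_eq ▸ hx₀).2
  have hf' : ∀ x ∈ closure Ω, f x₀ ≤ f x := fun x hx =>
    closure_minimal (fun y hy => (hf y hy).le) (isClosed_le continuous_const f.continuous) hx
  refine ⟨(InnerProductSpace.toDual ℝ E).symm f, fun x hx hne => ?_⟩
  rw [InnerProductSpace.toDual_symm_apply, map_sub, sub_pos]
  refine (hf' x hx).lt_of_ne fun heq => ?_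
  have hmid : (1 / 2 : ℝ) • x + (1 / 2 : ℝ) • x₀ ∈ Ω := by
    have := hstrict hx (frontier_subset_closure hx₀) hne one_half_pos one_half_pos (add_halves 1)
    have hne : (interior Ω).Nonempty := hΩ.interior_eq.symm ▸ closure_nonempty_iff.1 ⟨x, hx⟩
    rwa [hconv.interior_closure_eq_interior_of_nonempty_interior hne, hΩ.interior_eq] at this
  have := hf _ hmid
  simp only [map_add, map_smul, ← heq, smul_eq_mul] at this
  linarith

theorem exists_forall_le_mul {X : Type*} [TopologicalSpace X] [T2Space X] {K : Set X}
    {g h : X → ℝ} (hK : IsCompact K) (hg : ContinuousOn g K) (hh : ContinuousOn h K)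
    (hh0 : ∀ x ∈ K, 0 ≤ h x) (hgh : ∀ x ∈ K, h x = 0 → g x < 0) :
    ∃ L, ∀ x ∈ K, g x ≤ L * h x := by
  set K' := K ∩ g ⁻¹' Ici 0
  have hK' : IsCompact K' := hK.of_isClosed_subset
    (hg.preimage_isClosed_of_isClosed hK.isClosed isClosed_Ici) inter_subset_left
  have hpos : ∀ x ∈ K', 0 < h x := fun x hx =>
    (hh0 x hx.1).lt_of_ne' fun h0 => (hgh x hx.1 h0).not_ge hx.2
  obtain ⟨L, hL⟩ := hK'.bddAbove_image <| (hg.mono inter_subset_left).div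
    (hh.mono inter_subset_left) fun x hx => (hpos x hx).ne'
  refine ⟨max L 0, fun x hx => ?_⟩
  rcases lt_or_ge (g x) 0 with hneg | hnonneg
  · exact hneg.le.trans (mul_nonneg (le_max_right L 0) (hh0 x hx))
  · have hx' : x ∈ K' := ⟨hx, hnonneg⟩
    exact (div_le_iff₀ (hpos x hx')).1 ((hL (mem_image_of_mem _ hx')).trans (le_max_left L 0))

variable [FiniteDimensional ℝ E]

theorem hasBarriers_of_strictConvex (hF : IsElliptic F) (hΩ : IsOpen Ω) (hconv : Convex ℝ Ω)
    (hstrict : StrictConvex ℝ (closure Ω)) (hb : Bornology.IsBounded Ω)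
    (hφ : ContinuousOn φ (frontier Ω)) {c : ℝ} (hc : 0 ≤ F (c • 1)) : HasBarriers F Ω φ := by
  intro x₀ hx₀ ε hε
  have := FiniteDimensional.proper ℝ E
  have := FiniteDimensional.complete ℝ E
  have hK : IsCompact (frontier Ω) :=
    hb.isCompact_closure.of_isClosed_subset isClosed_frontier frontier_subset_closure
  obtain ⟨ν, hν⟩ := exists_forall_inner_pos_of_strictConvex hΩ hconv hstrict hx₀
  obtain ⟨L, hL⟩ : ∃ L, ∀ x ∈ frontier Ω,
      φ x₀ - ε + c / 2 * ‖x - x₀‖ ^ 2 - φ x ≤ L * ⟪ν, x - x₀⟫ := by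
    refine exists_forall_le_mul hK (.sub (by fun_prop) hφ) (by fun_prop) (fun x hx => ?_)
      fun x hx h0 => ?_
    · rcases eq_or_ne x x₀ with rfl | hne
      · simp
      · exact (hν x (frontier_subset_closure hx) hne).le
    · obtain rfl : x = x₀ := not_imp_comm.1 (hν x (frontier_subset_closure hx)) h0.not_gt
      simpa
  refine ⟨quadraticAt x₀ (φ x₀ - ε) (-L • ν) (c • 1), continuous_quadraticAt,
    ⟨continuous_quadraticAt.upperSemicontinuous.upperSemicontinuousOn _,
      isJetSubsolution_quadraticAt hF _ _ _ _ ?_ hc, fun x hx => ?_⟩, quadraticAt_self.ge⟩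
  · simpa using isSymmetric_add_smul_one (T := (0 : E →L[ℝ] E)) .zero c
  · rw [← zero_add (c • 1), quadraticAt_add_smul_one]
    simp only [quadraticAt, real_inner_smul_left, zero_apply, inner_zero_left]
    linear_combination hL x hx

theorem exists_continuousOn_isJetSubsolution_of_strictConvex (hF : IsElliptic F) (hΩ : IsOpen Ω)
    (hne : Ω.Nonempty) (hconv : Convex ℝ Ω) (hstrict : StrictConvex ℝ (closure Ω))
    (hb : Bornology.IsBounded Ω) (hφ : ContinuousOn φ (frontier Ω)) {c c' : ℝ}
    (hc : 0 ≤ F (c • 1)) (hc' : F (c' • 1) ≤ 0) :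
    ∃ u, ContinuousOn u (closure Ω) ∧ IsJetSubsolution F Ω u ∧
      IsJetSubsolution (dualOperator F) Ω (-u) ∧ EqOn u φ (frontier Ω) := by
  have := hF.nontrivial
  have hfrontier : (frontier Ω).Nonempty := nonempty_frontier_iff.2
    ⟨hne, fun huniv => NormedSpace.unbounded_univ ℝ E (huniv ▸ hb)⟩
  refine exists_continuousOn_isJetSubsolution hF hΩ hb hfrontier
    (hasBarriers_of_strictConvex hF hΩ hconv hstrict hb hφ hc)
    (hasBarriers_of_strictConvex hF.dualOperator hΩ hconv hstrict hb hφ.neg (c := -c') ?_)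
  simpa [dualOperator] using hc'

end StrictlyConvex

section UniformlyConvex

variable {n : ℕ} {Ω : Set (EuclideanSpace ℝ (Fin n))}

theorem IsUniformlyConvexDomain.exists_forall_inner_pos (hΩ : IsUniformlyConvexDomain Ω)
    {x₀ : EuclideanSpace ℝ (Fin n)} (hx₀ : x₀ ∈ frontier Ω) :
    ∃ ν, ∀ x ∈ closure Ω, x ≠ x₀ → 0 < ⟪x - x₀, ν⟫ := by
  obtain ⟨κ, hκ, hcurv⟩ := hΩ.curvature
  obtain ⟨ν, -, hν⟩ := hcurv x₀ hx₀
  refine ⟨ν, fun x hx hne => ?_⟩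
  obtain ⟨U, hU, hx₀U, hUν⟩ := mem_nhdsWithin.1 hν
  have hUcl : ∀ y ∈ U ∩ closure Ω, κ / 2 * ‖y - x₀‖ ^ 2 ≤ ⟪y - x₀, ν⟫ := fun y hy =>
    closure_minimal hUν (isClosed_le (by fun_prop) (by fun_prop)) (hU.inter_closure hy)
  have hseg : Tendsto (fun t : ℝ => x₀ + t • (x - x₀)) (𝓝[>] 0) (𝓝 x₀) :=
    ((by fun_prop : Continuous fun t : ℝ => x₀ + t • (x - x₀)).tendsto' 0 x₀ (by simp)).mono_left
      nhdsWithin_le_nhds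
  obtain ⟨t, htU, ht0, ht1⟩ :=
    ((hseg.eventually_mem (hU.mem_nhds hx₀U)).and (Ioo_mem_nhdsGT one_pos)).exists
  have ht := hUcl _ ⟨htU, hΩ.convex.closure.add_smul_sub_mem (frontier_subset_closure hx₀) hx
    ⟨ht0.le, ht1.le⟩⟩
  rw [add_sub_cancel_left, real_inner_smul_left] at ht
  have hpos : 0 < κ / 2 * ‖t • (x - x₀)‖ ^ 2 := by
    have := norm_pos_iff.2 (smul_ne_zero ht0.ne' (sub_ne_zero.2 hne))
    positivity
  exact pos_of_mul_pos_right (hpos.trans_le ht) ht0.le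

theorem IsUniformlyConvexDomain.strictConvex_closure (hΩ : IsUniformlyConvexDomain Ω) :
    StrictConvex ℝ (closure Ω) := by
  intro x hx y hy hxy a b ha hb hab
  by_contra hz
  obtain rfl : a = 1 - b := eq_sub_of_add_eq hab
  set z := (1 - b) • x + b • y
  have hzcl : z ∈ closure Ω := hΩ.convex.closure hx hy ha.le hb.le hab
  have hzΩ : z ∉ Ω := fun h => hz (interior_mono subset_closure (hΩ.isOpen.interior_eq.symm ▸ h))
  have hzfrontier : z ∈ frontier Ω := by
    rw [hΩ.isOpen.frontier_eq]
    exact ⟨hzcl, hzΩ⟩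
  obtain ⟨ν, hν⟩ := hΩ.exists_forall_inner_pos hzfrontier
  have hxz : x - z = b • (x - y) := by module
  have hyz : y - z = -((1 - b) • (x - y)) := by module
  have hxpos := hν x hx (sub_ne_zero.1 (hxz ▸ smul_ne_zero hb.ne' (sub_ne_zero.2 hxy)))
  have hypos := hν y hy
    (sub_ne_zero.1 (hyz ▸ neg_ne_zero.2 (smul_ne_zero ha.ne' (sub_ne_zero.2 hxy))))
  rw [hxz, real_inner_smul_left] at hxpos
  rw [hyz, inner_neg_left, real_inner_smul_left, neg_pos] at hypos
  exact (pos_of_mul_pos_right hxpos hb.le).not_gt (neg_of_mul_neg_right hypos ha.le)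

end UniformlyConvex

section Hessian

variable {E : Type*} [NormedAddCommGroup E] [InnerProductSpace ℝ E]
  {F : (E →L[ℝ] E) → ℝ} {Ω : Set E} {f u : E → ℝ} {x b : E} {T : E →L[ℝ] E}

theorem hasFDerivAt_quadraticAt (hT : T.IsSymmetric) (x : E) (c : ℝ) (b y : E) :
    HasFDerivAt (quadraticAt x c b T) (innerSL ℝ (b + T (y - x))) y := by
  have hid : HasFDerivAt (fun y : E => y - x) (.id ℝ E) y := (hasFDerivAt_id y).sub_const x
  refine (((hasFDerivAt_const b y).inner ℝ hid).const_add c |>.add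
    (((T.hasFDerivAt.comp y hid).inner ℝ hid).const_mul (1 / 2))).congr_fderiv ?_
  ext d
  have hsymm : ⟪T d, y - x⟫ = ⟪T (y - x), d⟫ := (hT d (y - x)).trans (real_inner_comm _ _)
  simp only [Function.comp_apply, ContinuousLinearMap.comp_id, add_apply, smul_apply,
    ContinuousLinearMap.comp_apply, ContinuousLinearMap.prod_apply, ContinuousLinearMap.id_apply,
    zero_apply, fderivInnerCLM_apply, inner_zero_left, hsymm, smul_eq_mul, map_add,
    coe_innerSL_apply]
  ring

theorem contDiff_quadraticAt : ContDiff ℝ 2 (quadraticAt x c b T) := by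
  have hid : ContDiff ℝ 2 fun y => y - x := contDiff_id.sub contDiff_const
  exact (contDiff_const.add (contDiff_const.inner ℝ hid)).add
    (contDiff_const.mul ((T.contDiff.comp hid).inner ℝ hid))

variable [CompleteSpace E]

/-- The Hessian of `f` at `x` as an operator: `⟪hessian f x v, w⟫` is the second derivative of `f`
at `x` in the directions `v` and `w`. -/
noncomputable def hessian (f : E → ℝ) (x : E) : E →L[ℝ] E :=
  InnerProductSpace.continuousLinearMapOfBilin (𝕜 := ℝ) (fderiv ℝ (fderiv ℝ f) x)

theorem inner_hessian (v w : E) : ⟪hessian f x v, w⟫ = fderiv ℝ (fderiv ℝ f) x v w :=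
  InnerProductSpace.continuousLinearMapOfBilin_apply _ _ _

theorem hessian_neg : hessian (-f) x = -hessian f x := by
  have h : fderiv ℝ (-f) = -fderiv ℝ f := funext fun _ => fderiv_neg
  ext1 v
  refine ext_inner_right ℝ fun w => ?_
  rw [inner_hessian, h, fderiv_neg]
  simp only [neg_apply, inner_neg_left, inner_hessian]

theorem isSymmetric_hessian (hf : ContDiffAt ℝ 2 f x) : (hessian f x).IsSymmetric := fun v w =>
  calc ⟪hessian f x v, w⟫
    _ = ⟪hessian f x w, v⟫ := by
      rw [inner_hessian, inner_hessian, (hf.isSymmSndFDerivAt (by simp)).eq]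
    _ = ⟪v, hessian f x w⟫ := real_inner_comm _ _

theorem hessian_quadraticAt (hT : T.IsSymmetric) (x : E) (c : ℝ) (b y : E) :
    hessian (quadraticAt x c b T) y = T := by
  have hfderiv : fderiv ℝ (quadraticAt x c b T) = fun y => innerSL ℝ (b + T (y - x)) :=
    funext fun y => (hasFDerivAt_quadraticAt hT x c b y).fderiv
  have hfderiv₂ : HasFDerivAt (fun y => innerSL ℝ (b + T (y - x))) ((innerSL ℝ).comp T) y :=
    (innerSL ℝ).hasFDerivAt.comp y
      ((T.hasFDerivAt.comp y ((hasFDerivAt_id y).sub_const x)).const_add b)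
  ext1 v
  refine ext_inner_right ℝ fun w => ?_
  rw [inner_hessian, hfderiv, hfderiv₂.fderiv]
  rfl

theorem eventually_abs_sub_quadraticAt_le (hf : ContDiffAt ℝ 2 f x) {γ : ℝ} (hγ : 0 < γ) :
    ∀ᶠ y in 𝓝 x, |f y - quadraticAt x (f x) (gradient f x) (hessian f x) y| ≤ γ * ‖y - x‖ ^ 2 := by
  set Q := quadraticAt x (f x) (gradient f x) (hessian f x)
  have hsnd : HasFDerivAt (fderiv ℝ f) (fderiv ℝ (fderiv ℝ f) x) x :=
    ((hf.fderiv_right (m := 1) le_rfl).differentiableAt one_ne_zero).hasFDerivAt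
  have hfst : ∀ᶠ y in 𝓝 x, HasFDerivAt f (fderiv ℝ f y) y :=
    (hf.eventually (by simp)).mono fun y hy => (hy.differentiableAt two_ne_zero).hasFDerivAt
  obtain ⟨ρ, hρ, hball⟩ := Metric.eventually_nhds_iff_ball.1
    (((hasFDerivAt_iff_isLittleO.1 hsnd).def hγ).and hfst)
  filter_upwards [Metric.ball_mem_nhds x hρ] with y hy
  have hseg : segment ℝ x y ⊆ Metric.ball x ρ :=
    (convex_ball x ρ).segment_subset (Metric.mem_ball_self hρ) hy
  have hderiv : ∀ z ∈ segment ℝ x y, HasFDerivWithinAt (fun z => f z - Q z)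
      (fderiv ℝ f z - fderiv ℝ f x - fderiv ℝ (fderiv ℝ f) x (z - x)) (segment ℝ x y) z := by
    intro z hz
    refine ((hball z (hseg hz)).2.sub (hasFDerivAt_quadraticAt (isSymmetric_hessian hf) _ _ _ z)
      |>.congr_fderiv ?_).hasFDerivWithinAt
    ext v
    simp only [sub_apply, innerSL_apply_apply, inner_add_left, inner_hessian, gradient,
      InnerProductSpace.toDual_symm_apply]
    ring
  have hbound : ∀ z ∈ segment ℝ x y,
      ‖fderiv ℝ f z - fderiv ℝ f x - fderiv ℝ (fderiv ℝ f) x (z - x)‖ ≤ γ * ‖y - x‖ := fun z hz =>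
    (hball z (hseg hz)).1.trans
      (mul_le_mul_of_nonneg_left (norm_sub_le_of_mem_segment hz) hγ.le)
  have := (convex_segment x y).norm_image_sub_le_of_norm_hasFDerivWithin_le hderiv hbound
    (left_mem_segment ℝ x y) (right_mem_segment ℝ x y)
  rwa [show Q x = f x from quadraticAt_self, sub_self, sub_zero, Real.norm_eq_abs, mul_assoc,
    ← sq] at this

/-- Viscosity subsolutions may be tested with quadratic polynomials only: replacing a test function
`f` by its Taylor polynomial costs an arbitrarily small multiple of `‖y - x‖ ^ 2`. -/
theorem isJetSubsolution_iff_forall_contDiffOn (hF : IsElliptic F) (hΩ : IsOpen Ω) :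
    IsJetSubsolution F Ω u ↔ ∀ f, ContDiffOn ℝ 2 f Ω → ∀ x ∈ Ω,
      IsLocalMaxOn (fun y => u y - f y) Ω x → 0 ≤ F (hessian f x) := by
  refine ⟨fun hu f hf x hx hmax => ?_, fun hu x hx b T hT hj => ?_⟩
  · have hfx : ContDiffAt ℝ 2 f x := hf.contDiffAt (hΩ.mem_nhds hx)
    have hsymm := isSymmetric_hessian hfx
    refine hF.nonneg_of_forall_pos fun ε hε =>
      hu x hx (gradient f x) _ (isSymmetric_add_smul_one hsymm ε) ?_
    filter_upwards [hmax.isLocalMax (hΩ.mem_nhds hx),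
      eventually_abs_sub_quadraticAt_le hfx (half_pos hε)] with y hy htaylor
    rw [quadraticAt_add_smul_one]
    have := (abs_le.1 htaylor).2
    simp only [quadraticAt] at this ⊢
    linarith
  · rw [← hessian_quadraticAt hT x (u x) b x]
    refine hu _ contDiff_quadraticAt.contDiffOn x hx ?_
    filter_upwards [nhdsWithin_le_nhds hj] with y hy
    rw [quadraticAt_self]
    linarith

theorem isJetSubsolution_dualOperator_neg_iff (hF : IsElliptic F) (hΩ : IsOpen Ω) :
    IsJetSubsolution (dualOperator F) Ω (-u) ↔ ∀ f, ContDiffOn ℝ 2 f Ω → ∀ x ∈ Ω,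
      IsLocalMinOn (fun y => u y - f y) Ω x → F (hessian f x) ≤ 0 := by
  rw [isJetSubsolution_iff_forall_contDiffOn hF.dualOperator hΩ]
  have hneg (f : E → ℝ) (x : E) : IsLocalMaxOn (fun y => (-u) y - (-f) y) Ω x ↔
      IsLocalMinOn (fun y => u y - f y) Ω x := by
    refine eventually_congr (.of_forall fun y => ?_)
    simp only [Pi.neg_apply]
    constructor <;> intro h <;> linarith
  refine ⟨fun h f hf x hx hmin => ?_, fun h f hf x hx hmax => ?_⟩
  · simpa [dualOperator, hessian_neg] using h (-f) hf.neg x hx ((hneg f x).2 hmin)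
  · have := h (-f) hf.neg x hx ((hneg (-f) x).1 (by rwa [neg_neg]))
    simpa [dualOperator, hessian_neg] using this

end Hessian

section Bridge

variable {n : ℕ} {Ω : Set (EuclideanSpace ℝ (Fin n))} {ψ : ℝ} {u : EuclideanSpace ℝ (Fin n) → ℝ}

theorem lagrangianPhase_hessianMatrix (f : EuclideanSpace ℝ (Fin n) → ℝ)
    (x : EuclideanSpace ℝ (Fin n)) :
    lagrangianPhase (hessianMatrix f x) = operatorPhase (hessian f x) := by
  have h : LinearMap.toMatrix (EuclideanSpace.basisFun (Fin n) ℝ).toBasis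
      (EuclideanSpace.basisFun (Fin n) ℝ).toBasis (hessian f x) =
        (hessianMatrix f x).transpose := by
    ext i j
    simp [LinearMap.toMatrix_apply, hessianMatrix, ← inner_hessian,
      EuclideanSpace.inner_single_right]
  rw [lagrangianPhase, operatorPhase, ← LinearMap.charpoly_toMatrix _
    (EuclideanSpace.basisFun (Fin n) ℝ).toBasis, h, Matrix.charpoly_transpose]

theorem isViscositySubsolution_iff [NeZero n] (hΩ : IsOpen Ω) :
    IsViscositySubsolution Ω ψ u ↔
      UpperSemicontinuousOn u Ω ∧ IsJetSubsolution (fun T => operatorPhase T - ψ) Ω u := by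
  simp only [isJetSubsolution_iff_forall_contDiffOn (isElliptic_operatorPhase.sub_const ψ) hΩ,
    sub_nonneg, ← lagrangianPhase_hessianMatrix]
  exact ⟨fun h => ⟨h.usc, h.test⟩, fun h => ⟨h.1, h.2⟩⟩

theorem isViscositySupersolution_iff [NeZero n] (hΩ : IsOpen Ω) :
    IsViscositySupersolution Ω ψ u ↔ LowerSemicontinuousOn u Ω ∧
      IsJetSubsolution (dualOperator fun T => operatorPhase T - ψ) Ω (-u) := by
  simp only [isJetSubsolution_dualOperator_neg_iff (isElliptic_operatorPhase.sub_const ψ) hΩ,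
    sub_nonpos, ← lagrangianPhase_hessianMatrix]
  exact ⟨fun h => ⟨h.lsc, h.test⟩, fun h => ⟨h.1, h.2⟩⟩

end Bridge

section Dirichlet

variable {n : ℕ} {Ω : Set (EuclideanSpace ℝ (Fin n))} {ψ : ℝ}
  {φ u v : EuclideanSpace ℝ (Fin n) → ℝ}

theorem exists_operatorPhase_smul_one_eq
    (hψ : ψ ∈ Ioo (-(n * (Real.pi / 2))) (n * (Real.pi / 2))) :
    ∃ c : ℝ, operatorPhase (c • 1 : EuclideanSpace ℝ (Fin n) →L[ℝ] _) = ψ := by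
  have hn : 0 < (n : ℝ) := by
    have := Real.pi_pos
    by_contra! h
    nlinarith [hψ.1.trans hψ.2]
  refine ⟨Real.tan (ψ / n), ?_⟩
  rw [operatorPhase_smul_one, finrank_euclideanSpace_fin, Real.arctan_tan,
    mul_div_cancel₀ _ hn.ne']
  · rw [lt_div_iff₀ hn]
    linarith [hψ.1]
  · rw [div_lt_iff₀ hn]
    linarith [hψ.2]

theorem isDirichletSolution_iff [NeZero n] (hΩ : IsOpen Ω) :
    IsDirichletSolution Ω ψ φ u ↔ ContinuousOn u (closure Ω) ∧
      IsJetSubsolution (fun T => operatorPhase T - ψ) Ω u ∧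
      IsJetSubsolution (dualOperator fun T => operatorPhase T - ψ) Ω (-u) ∧
      EqOn u φ (frontier Ω) := by
  refine ⟨fun h => ⟨h.continuousOn, ((isViscositySubsolution_iff hΩ).1 h.subsolution).2,
    ((isViscositySupersolution_iff hΩ).1 h.supersolution).2, h.boundary⟩,
    fun ⟨hcont, hsub, hsuper, hbd⟩ => ?_⟩
  have hcontΩ := hcont.mono subset_closure
  exact ⟨hcont, (isViscositySubsolution_iff hΩ).2 ⟨hcontΩ.upperSemicontinuousOn, hsub⟩,
    (isViscositySupersolution_iff hΩ).2 ⟨hcontΩ.lowerSemicontinuousOn, hsuper⟩, hbd⟩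

theorem IsDirichletSolution.le [NeZero n] (hΩ : IsOpen Ω) (hb : Bornology.IsBounded Ω)
    (hu : IsDirichletSolution Ω ψ φ u) (hv : IsDirichletSolution Ω ψ φ v) {x}
    (hx : x ∈ closure Ω) : u x ≤ v x := by
  obtain ⟨hucont, husub, -, hubd⟩ := (isDirichletSolution_iff hΩ).1 hu
  obtain ⟨hvcont, -, hvsuper, hvbd⟩ := (isDirichletSolution_iff hΩ).1 hv
  refine sub_nonpos.1 (husub.add_nonpos (isElliptic_operatorPhase.sub_const ψ) hΩ hb
    hucont.upperSemicontinuousOn hvcont.neg.upperSemicontinuousOn hvsuper (fun y hy => ?_) x hx)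
  simp [hubd hy, hvbd hy]

end Dirichlet

theorem theorem1p2_general {n : ℕ} (Ω : Set (EuclideanSpace ℝ (Fin n))) (hΩ : IsOpen Ω)
    (hne : Ω.Nonempty) (hconv : Convex ℝ Ω) (hstrict : StrictConvex ℝ (closure Ω))
    (hΩb : Bornology.IsBounded Ω) (φ : EuclideanSpace ℝ (Fin n) → ℝ)
    (hφ : ContinuousOn φ (frontier Ω)) (ψ : ℝ)
    (hψ : ψ ∈ Set.Ioo (-(n * (Real.pi / 2))) (n * (Real.pi / 2))) :
    ∃ u : EuclideanSpace ℝ (Fin n) → ℝ, IsDirichletSolution Ω ψ φ u ∧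
      ∀ v : EuclideanSpace ℝ (Fin n) → ℝ, IsDirichletSolution Ω ψ φ v →
        Set.EqOn v u (closure Ω) := by
  have : NeZero n := ⟨by rintro rfl; simp at hψ⟩
  obtain ⟨c, hc⟩ := exists_operatorPhase_smul_one_eq hψ
  obtain ⟨u, hu⟩ := exists_continuousOn_isJetSubsolution_of_strictConvex
    (isElliptic_operatorPhase.sub_const ψ) hΩ hne hconv hstrict hΩb hφ
    (sub_nonneg.2 hc.ge) (sub_nonpos.2 hc.le)
  have hsol : IsDirichletSolution Ω ψ φ u := (isDirichletSolution_iff hΩ).2 hu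
  exact ⟨u, hsol, fun v hv x hx =>
    le_antisymm (hv.le hΩ hΩb hsol hx) (hsol.le hΩ hΩb hv hx)⟩

theorem theorem1p2 {n : ℕ} (Ω : Set (EuclideanSpace ℝ (Fin n)))
    (hΩ : IsUniformlyConvexDomain Ω) (hΩb : Bornology.IsBounded Ω)
    (φ : EuclideanSpace ℝ (Fin n) → ℝ) (hφ : ContinuousOn φ (frontier Ω))
    (ψ : ℝ) (hψ : ψ ∈ Set.Ioo (-(n * (Real.pi / 2))) (n * (Real.pi / 2))) :
    ∃ u : EuclideanSpace ℝ (Fin n) → ℝ, IsDirichletSolution Ω ψ φ u ∧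
      ∀ v : EuclideanSpace ℝ (Fin n) → ℝ, IsDirichletSolution Ω ψ φ v →
        Set.EqOn v u (closure Ω) :=
  theorem1p2_general Ω hΩ.isOpen hΩ.nonempty hΩ.convex hΩ.strictConvex_closure hΩb φ hφ ψ hψ
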